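/- Let $\Omega\subset\mathbb{R}^3$ be a non-empty bounded open set (for instance a connected one with $C^2$ boundary). Let $\mu>0$ and $\lambda\in\mathbb{R}$ with $3\lambda+2\mu>0$, put $m=\min\{\mu,3\lambda+2\mu\}$, and let $\Delta^*u=\mu\Delta u+(\lambda+\mu)\nabla(\nabla\cdot u)$ be the Lamé operator. Let $\rho\in L^\infty(\Omega)$ be real valued and positive almost everywhere, with (essential) infimum $\rho_*=\inf_\Omega\rho$ and (essential) supremum $\rho^*=\sup_\Omega\rho$. Let $H^1_0(\Omega)$ and $H^2_0(\Omega)$ be the closures of $C_c^\infty(\Omega)$ in the complex Sobolev spaces $H^1(\Omega)$ and $H^2(\Omega)$; $(H^2_0(\Omega))^3$ carries the full $H^2$ norm. Let $\lambda_1(\Omega)$ be the smallest Dirichlet eigenvalue of $-\Delta$ in $\Omega$, i.e. the smallest real $\Lambda$ for which some $0\ne w\in H^1_0(\Omega)$ satisfies $\int_\Omega\nabla w\cdot\nabla\overline v\,dx=\Lambda\int_\Omega w\,\overline v\,dx$ for all $v\in H^1_0(\Omega)$. For $\omega\in\mathbb{R}$ and $u,h\in(H^2_0(\Omega))^3$ let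 $$a(u,h)=\int_\Omega(1-\rho)^{-1}(\Delta^*+\omega^2)u\cdot(\Delta^*+\omega^2)\overline h\,dx+\omega^2\int_\Omega\nabla u:\mathbb{C}:\nabla\overline h\,dx-\omega^4\int_\Omega u\cdot\overline h\,dx,$$ where $\nabla u:\mathbb{C}:\nabla\overline h=\sum_{i,j,k,l}\partial_ju_i\,C_{ijkl}\,\partial_l\overline{h_k}$ and $C_{ijkl}=\lambda\delta_{ij}\delta_{kl}+\mu(\delta_{ik}\delta_{jl}+\delta_{il}\delta_{jk})$. Suppose that $$0<\omega^2<\min\Big\{\frac{m\,\lambda_1(\Omega)}{\rho^*},\;m\,\lambda_1(\Omega)\Big\}.$$ Then $a(u,u)$ is coercive on $(H^2_0(\Omega))^3$ whenever $\rho_*>1$ or $\rho^*<1$, in the following sense. If $\rho_*>1$, there is a constant $C>0$ such that for all $u\in(H^2_0(\Omega))^3$ the number $a(u,u)$ is real and $-a(u,u)\ge C\|u\|^2_{H^2(\Omega)}$. If $\rho^*<1$, there is a constant $C>0$ such that for all $u\in(H^2_0(\Omega))^3$ the number $a(u,u)$ is real and $a(u,u)\ge C\|u\|^2_{H^2(\Omega)}$.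 -/

import Mathlib

open MeasureTheory
open scoped ComplexConjugate

noncomputable section

namespace ElasticITP

/-- Three-dimensional Euclidean space. -/
abbrev E3 : Type := EuclideanSpace ℝ (Fin 3)

/-- Classical partial derivative `∂φ/∂xᵢ`. -/
def classicalPartial (i : Fin 3) (φ : E3 → ℂ) (x : E3) : ℂ :=
  fderiv ℝ φ x (EuclideanSpace.single i 1)

/-- `φ ∈ C_c^∞(Ω)`: smooth, with compact support contained in `Ω`. -/
def IsTestFunction (Ω : Set E3) (φ : E3 → ℂ) : Prop :=
  ContDiff ℝ (⊤ : ℕ∞) φ ∧ HasCompactSupport φ ∧ tsupport φ ⊆ Ω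

/-- `g` is a weak (distributional) partial derivative `∂u/∂xᵢ` on `Ω`. -/
def HasWeakPartial (Ω : Set E3) (i : Fin 3) (u g : E3 → ℂ) : Prop :=
  LocallyIntegrableOn u Ω volume ∧ LocallyIntegrableOn g Ω volume ∧
    ∀ φ : E3 → ℂ, IsTestFunction Ω φ →
      ∫ x in Ω, u x * classicalPartial i φ x = - ∫ x in Ω, g x * φ x

open Classical in
/-- The weak partial derivative `∂u/∂xᵢ` on `Ω`; on an open set it is unique up to null sets.
It is set to `0` when `u` has none. -/
def weakPartial (Ω : Set E3) (i : Fin 3) (u : E3 → ℂ) : E3 → ℂ :=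
  if h : ∃ g : E3 → ℂ, HasWeakPartial Ω i u g then h.choose else 0

/-- `u ∈ L²(Ω)`. -/
def MemL2 (Ω : Set E3) (u : E3 → ℂ) : Prop :=
  MemLp u 2 (volume.restrict Ω)

/-- `u ∈ H¹(Ω)`. -/
def MemH1 (Ω : Set E3) (u : E3 → ℂ) : Prop :=
  MemL2 Ω u ∧ ∀ i, ∃ g : E3 → ℂ, MemL2 Ω g ∧ HasWeakPartial Ω i u g

/-- `u ∈ H²(Ω)`. -/
def MemH2 (Ω : Set E3) (u : E3 → ℂ) : Prop :=
  MemH1 Ω u ∧ ∀ i, MemH1 Ω (weakPartial Ω i u)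

/-- `‖u‖²` in `L²(Ω)`. -/
def l2NormSq (Ω : Set E3) (u : E3 → ℂ) : ℝ :=
  ∫ x in Ω, ‖u x‖ ^ 2

/-- `‖u‖²` in `H¹(Ω)`. -/
def h1NormSq (Ω : Set E3) (u : E3 → ℂ) : ℝ :=
  l2NormSq Ω u + ∑ i, l2NormSq Ω (weakPartial Ω i u)

/-- `‖u‖²` in `H²(Ω)`. -/
def h2NormSq (Ω : Set E3) (u : E3 → ℂ) : ℝ :=
  l2NormSq Ω u + ∑ i, l2NormSq Ω (weakPartial Ω i u)
    + ∑ i, ∑ j, l2NormSq Ω (weakPartial Ω i (weakPartial Ω j u))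

/-- `u ∈ H¹₀(Ω)`: the closure of `C_c^∞(Ω)` in `H¹(Ω)`. -/
def MemH10 (Ω : Set E3) (u : E3 → ℂ) : Prop :=
  MemH1 Ω u ∧ ∀ ε : ℝ, 0 < ε → ∃ φ, IsTestFunction Ω φ ∧ h1NormSq Ω (u - φ) < ε

/-- `u ∈ H²₀(Ω)`: the closure of `C_c^∞(Ω)` in `H²(Ω)`. -/
def MemH20 (Ω : Set E3) (u : E3 → ℂ) : Prop :=
  MemH2 Ω u ∧ ∀ ε : ℝ, 0 < ε → ∃ φ, IsTestFunction Ω φ ∧ h2NormSq Ω (u - φ) < ε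

/-- `Λ` is an eigenvalue of `-Δ` on `Ω` with Dirichlet boundary condition (weak formulation):
`-Δ w = Λ w` in `Ω`, `w ∈ H¹₀(Ω)`, `w ≠ 0`. -/
def IsDirichletEigenvalue (Ω : Set E3) (Λ : ℝ) : Prop :=
  ∃ w : E3 → ℂ, MemH10 Ω w ∧ ¬ (w =ᵐ[volume.restrict Ω] 0) ∧
    ∀ v : E3 → ℂ, MemH10 Ω v →
      ∫ x in Ω, ∑ i, weakPartial Ω i w x * conj (weakPartial Ω i v x)
        = (Λ : ℂ) * ∫ x in Ω, w x * conj (v x)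

/-- The first (smallest) Dirichlet eigenvalue `λ₁(Ω)` of `-Δ` in `Ω`. -/
def firstDirichletEigenvalue (Ω : Set E3) : ℝ :=
  sInf {Λ : ℝ | IsDirichletEigenvalue Ω Λ}

/-- A vector field with three complex components. -/
abbrev VField : Type := Fin 3 → E3 → ℂ

/-- `u ∈ (H²₀(Ω))³`. -/
def MemH20Vec (Ω : Set E3) (u : VField) : Prop :=
  ∀ i, MemH20 Ω (u i)

/-- `‖u‖²` in `(H²₀(Ω))³`, the norm inherited from `(H²(Ω))³`. -/
def h2NormSqVec (Ω : Set E3) (u : VField) : ℝ :=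
  ∑ i, h2NormSq Ω (u i)

/-- Divergence `∇ · u`. -/
def divergence (Ω : Set E3) (u : VField) : E3 → ℂ :=
  fun x => ∑ j, weakPartial Ω j (u j) x

/-- The Lamé operator `Δ* u = μ Δ u + (λ + μ) ∇ (∇ · u)`. -/
def lame (lam mu : ℝ) (Ω : Set E3) (u : VField) : VField :=
  fun i x => (mu : ℂ) * ∑ j, weakPartial Ω j (weakPartial Ω j (u i)) x
    + ((lam + mu : ℝ) : ℂ) * weakPartial Ω i (divergence Ω u) x

/-- Kronecker's delta. -/
def kron (i j : Fin 3) : ℝ := if i = j then 1 else 0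

/-- The isotropic elastic moduli
`C_{ijkl} = λ δ_{ij} δ_{kl} + μ (δ_{ik} δ_{jl} + δ_{il} δ_{jk})`. -/
def moduli (lam mu : ℝ) (i j k l : Fin 3) : ℝ :=
  lam * (kron i j * kron k l) + mu * (kron i k * kron j l + kron i l * kron j k)

/-- The sesquilinear form
`a(u,h) = ∫ (1-ρ)⁻¹ (Δ*+ω²)u · conj((Δ*+ω²)h) + ω² ∫ ∇u : C : ∇(conj h) - ω⁴ ∫ u · conj h`. -/
def formA (lam mu : ℝ) (Ω : Set E3) (ρ : E3 → ℝ) (ω : ℝ) (u h : VField) : ℂ :=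
  (∫ x in Ω, (((1 - ρ x)⁻¹ : ℝ) : ℂ) *
      ∑ i, (lame lam mu Ω u i x + (ω : ℂ) ^ 2 * u i x)
        * conj (lame lam mu Ω h i x + (ω : ℂ) ^ 2 * h i x))
    + (ω : ℂ) ^ 2 * (∫ x in Ω, ∑ i, ∑ j, ∑ k, ∑ l,
        weakPartial Ω j (u i) x * (moduli lam mu i j k l : ℂ)
          * conj (weakPartial Ω l (h k) x))
    - (ω : ℂ) ^ 4 * ∫ x in Ω, ∑ i, u i x * conj (h i x)

end ElasticITP

end

/-! Write X = ‖Δ*u‖², D = ∫∇u:C:∇ū, N = ‖u‖². For u in (H²₀)³, integration by parts gives ⟨u, Δ*u⟩ =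
-D, hence ‖(Δ*+t)u‖² = X - 2tD + t²N for every real t (`MemH20Vec.sum_norm_sq_lame_add`), and a(u,u)
is the weighted integral of |(Δ*+ω²)u|² plus ω²D - ω⁴N (`MemH20Vec.formA_self`).

If ρ* < 1 the weight is at least 1 and a(u,u) ≥ X - ω²D. If ρ_* > 1 minus the weight is at least γ =
1/(ρ*-1), and -a(u,u) ≥ γ(X - (ω²+ρ*ω²)D + ω²·ρ*ω²·N). Both bounds have the shape X - (a+b)D + abN,
formally (κ-a)(κ-b) with κ the spectral variable of -Δ*. With K = mλ₁, the smallness of ω² says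
exactly that a, b < K, so it suffices that KN ≤ D: then X - (a+b)D + abN ≥ (1-a/K)(1-b/K)X
(`quadratic_lower_bound`), and X controls the full H² norm (`MemH20Vec.h2NormSqVec_le`).

The bound KN ≤ D follows from D = μ‖∇u‖² + (λ+μ)‖div u‖², where λ+μ > 0, and Poincaré's inequality
with constant λ₁ (`firstDirichletEigenvalue_mul_le`). Since λ₁ is defined as an infimum of
eigenvalues, the latter requires that the minimum of the Rayleigh quotient be an eigenvalue. A
minimizer exists by a quantitative Rellich estimate, proved with the Fourier transform
(`exists_functionals_test`, `exists_rayleigh_minimizer`). -/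

noncomputable section

namespace ElasticITP

open Filter Topology

/-! ### Abstract Rayleigh quotients in Hilbert space. -/

section Minimizer

variable {E G : Type*} [NormedAddCommGroup E] [InnerProductSpace ℂ E]
  [NormedAddCommGroup G] [InnerProductSpace ℂ G]

/-- If the quadratic form `‖v.2‖² - P ‖v.1‖²` is nonnegative on `K` and vanishes at `w`, then `w`
satisfies the associated Euler-Lagrange equation. -/
theorem inner_eq_of_isMin {K : Submodule ℂ (E × G)} {P : ℝ} {w : E × G} (hw : w ∈ K)
    (hmin : ∀ v ∈ K, P * ‖v.1‖ ^ 2 ≤ ‖v.2‖ ^ 2) (hw0 : ‖w.2‖ ^ 2 = P * ‖w.1‖ ^ 2)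
    {v : E × G} (hv : v ∈ K) :
    inner ℂ v.2 w.2 = (P : ℂ) * inner ℂ v.1 w.1 := by
  have key : ∀ v ∈ K, (inner ℂ v.2 w.2).re = P * (inner ℂ v.1 w.1).re := by
    intro v hv
    set b : ℝ := (inner ℂ v.2 w.2).re - P * (inner ℂ v.1 w.1).re with hb
    set q : ℝ := ‖v.2‖ ^ 2 - P * ‖v.1‖ ^ 2 with hq
    have h : ∀ t : ℝ, 0 ≤ t * t * q + 2 * t * b := by
      intro t
      have h1 := hmin _ (K.add_mem hw (K.smul_mem (t : ℂ) hv))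
      have e1 := @norm_add_sq ℂ E _ _ _ w.1 ((t : ℂ) • v.1)
      have e2 := @norm_add_sq ℂ G _ _ _ w.2 ((t : ℂ) • v.2)
      have s1 := inner_re_symm (𝕜 := ℂ) w.1 v.1
      have s2 := inner_re_symm (𝕜 := ℂ) w.2 v.2
      simp only [inner_smul_right, norm_smul, mul_pow, Complex.norm_real, Real.norm_eq_abs,
        sq_abs, RCLike.re_to_complex, Complex.re_ofReal_mul] at e1 e2 s1 s2
      simp only [Prod.fst_add, Prod.snd_add, Prod.smul_fst, Prod.smul_snd] at h1
      rw [e1, e2, s1, s2] at h1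
      rw [hb, hq]
      nlinarith
    have h0 : b = 0 := by
      by_contra hne
      have hq0 : 0 ≤ q := by
        have := hmin v hv
        rw [hq]; linarith
      -- The parabola t²q + 2tb is negative here unless b = 0; the shift q + 1 keeps the denominator
      -- positive when q = 0.
      have h2 := h (-b / (q + 1))
      have hq1 : 0 < q + 1 := by linarith
      have : -b / (q + 1) * (-b / (q + 1)) * q + 2 * (-b / (q + 1)) * b
          = -(b ^ 2 * (q + 2)) / (q + 1) ^ 2 := by field_simp; ring
      rw [this] at h2
      have hb2 : 0 < b ^ 2 := by positivity
      have : -(b ^ 2 * (q + 2)) / (q + 1) ^ 2 < 0 := by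
        apply div_neg_of_neg_of_pos _ (by positivity)
        have : 0 < b ^ 2 * (q + 2) := by positivity
        linarith
      linarith
    linarith
  apply Complex.ext
  · simpa using key v hv
  -- Replacing v by I•v turns real parts into imaginary parts.
  · have := key _ (K.smul_mem Complex.I hv)
    simp only [Prod.smul_fst, Prod.smul_snd, inner_smul_left, Complex.conj_I] at this
    simp at this
    simpa using this

theorem exists_tendsto_of_tendsto_norm_sub_sq {H ι : Type*} [NormedAddCommGroup H]
    [CompleteSpace H] {l : Filter ι} [NeBot l] {g : ι → H}
    (hg : Tendsto (fun p : ι × ι => ‖g p.1 - g p.2‖ ^ 2) (l ×ˢ l) (𝓝 0)) :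
    ∃ z, Tendsto g l (𝓝 z) := by
  refine cauchy_map_iff_exists_tendsto.1 ?_
  rw [cauchy_map_iff]
  refine ⟨inferInstance, ?_⟩
  rw [Metric.uniformity_eq_comap_nhds_zero, tendsto_comap_iff]
  have := hg.sqrt
  simpa [Function.comp_def, dist_eq_norm, Real.sqrt_sq] using this

/-- Existence of a minimizer of the Rayleigh quotient `‖f.2‖² / ‖f.1‖²` on a closed subspace for
which the first component is compact relative to the whole. -/
theorem exists_rayleigh_minimizer [CompleteSpace E] [CompleteSpace G] (K : Submodule ℂ (E × G)) (hK : IsClosed (K : Set (E × G)))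
    (hcpt : ∀ ε : ℝ, 0 < ε → ∃ (s : Finset (E →L[ℂ] ℂ)) (C : ℝ), ∀ f ∈ K,
      ‖f.1‖ ^ 2 ≤ ε * (‖f.1‖ ^ 2 + ‖f.2‖ ^ 2) + C * ∑ l ∈ s, ‖l f.1‖ ^ 2)
    (hne : ∃ f ∈ K, f.1 ≠ 0) :
    ∃ (P : ℝ) (w : E × G), w ∈ K ∧ w.1 ≠ 0 ∧
      (∀ v ∈ K, P * ‖v.1‖ ^ 2 ≤ ‖v.2‖ ^ 2) ∧
      ∀ v ∈ K, inner ℂ v.2 w.2 = (P : ℂ) * inner ℂ v.1 w.1 := by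
  set S : Set ℝ := {r | ∃ f ∈ K, ‖f.1‖ = 1 ∧ r = ‖f.2‖ ^ 2} with hS
  have normalize : ∀ f ∈ K, f.1 ≠ 0 →
      ∃ g ∈ K, ‖g.1‖ = 1 ∧ ‖g.2‖ ^ 2 = ‖f.2‖ ^ 2 / ‖f.1‖ ^ 2 := by
    intro f hf hf0
    have hn : ‖f.1‖ ≠ 0 := norm_ne_zero_iff.2 hf0
    refine ⟨((‖f.1‖⁻¹ : ℝ) : ℂ) • f, K.smul_mem _ hf, ?_, ?_⟩
    · simp only [Prod.smul_fst, norm_smul, Complex.norm_real, norm_inv, norm_norm]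
      field_simp
    · simp only [Prod.smul_snd, norm_smul, Complex.norm_real, norm_inv, norm_norm]
      field_simp
  have hSne : S.Nonempty := by
    obtain ⟨f, hf, hf0⟩ := hne
    obtain ⟨g, hg, hg1, -⟩ := normalize f hf hf0
    exact ⟨_, g, hg, hg1, rfl⟩
  have hSbdd : BddBelow S := ⟨0, by rintro r ⟨f, -, -, rfl⟩; positivity⟩
  set P := sInf S with hP
  have hmin : ∀ v ∈ K, P * ‖v.1‖ ^ 2 ≤ ‖v.2‖ ^ 2 := by
    intro v hv
    by_cases h0 : v.1 = 0
    · simp [h0]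
    · obtain ⟨g, hg, hg1, hg2⟩ := normalize v hv h0
      have : P ≤ ‖g.2‖ ^ 2 := csInf_le hSbdd ⟨g, hg, hg1, rfl⟩
      rw [hg2, le_div_iff₀ (by positivity)] at this
      exact this
  have hseq : ∀ n : ℕ, ∃ f ∈ K, ‖f.1‖ = 1 ∧ ‖f.2‖ ^ 2 < P + 1 / ((n : ℝ) + 1) := by
    intro n
    obtain ⟨r, ⟨f, hf, hf1, rfl⟩, hr⟩ := exists_lt_of_csInf_lt hSne
      (show sInf S < P + 1 / ((n : ℝ) + 1) by
        have : (0 : ℝ) < 1 / ((n : ℝ) + 1) := by positivity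
        linarith)
    exact ⟨f, hf, hf1, hr⟩
  choose f hfK hf1 hf2 using hseq
  -- Along an ultrafilter every bounded scalar sequence converges, so all functionals converge at
  -- once and no subsequence has to be extracted.
  set U : Ultrafilter ℕ := hyperfilter ℕ with hU
  have hUle : (U : Filter ℕ) ≤ atTop := by
    rw [← Nat.cofinite_eq_atTop]; exact hyperfilter_le_cofinite
  have hPlim : Tendsto (fun n => ‖(f n).2‖ ^ 2) U (𝓝 P) := by
    refine Tendsto.mono_left ?_ hUle
    refine tendsto_of_tendsto_of_tendsto_of_le_of_le tendsto_const_nhds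
      (h := fun n : ℕ => P + 1 / ((n : ℝ) + 1)) ?_ ?_ ?_
    · simpa using (tendsto_one_div_add_atTop_nhds_zero_nat (𝕜 := ℝ)).const_add P
    · intro n
      have := hmin _ (hfK n)
      rw [hf1 n] at this
      simpa using this
    · intro n; exact (hf2 n).le
  have hbdd : ∀ n, ‖(f n).2‖ ^ 2 ≤ P + 1 := by
    intro n
    have : 1 / ((n : ℝ) + 1) ≤ 1 := by
      rw [div_le_one (by positivity)]; linarith [Nat.cast_nonneg (α := ℝ) n]
    linarith [hf2 n]
  have hP0 : 0 ≤ P + 1 := (sq_nonneg _).trans (hbdd 0)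
  have hl : ∀ l : E →L[ℂ] ℂ, ∃ z, Tendsto (fun n => l (f n).1) U (𝓝 z) := by
    intro l
    obtain ⟨z, -, hz⟩ := (isCompact_closedBall (0 : ℂ) ‖l‖).ultrafilter_le_nhds
      (U.map fun n => l (f n).1) (by
        rw [Ultrafilter.coe_map, le_principal_iff, mem_map]
        refine univ_mem' fun n => ?_
        have := l.le_opNorm (f n).1
        rw [hf1 n, mul_one] at this
        simpa using this)
    exact ⟨z, hz⟩
  have hl' : ∀ l : E →L[ℂ] ℂ,
      Tendsto (fun p : ℕ × ℕ => ‖l ((f p.1).1 - (f p.2).1)‖ ^ 2) ((U : Filter ℕ) ×ˢ U) (𝓝 0) := by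
    intro l
    obtain ⟨z, hz⟩ := hl l
    have := (((hz.comp tendsto_fst).sub (hz.comp (tendsto_snd (f := (U : Filter ℕ))))).norm).pow 2
    simpa [Function.comp_def] using this
  -- The compactness bound is applied to differences: their total norm squared stays below M, so the
  -- ε-term is at most δ/2, and the finitely many functionals tend to zero.
  have hc1 : Tendsto (fun p : ℕ × ℕ => ‖(f p.1).1 - (f p.2).1‖ ^ 2) ((U : Filter ℕ) ×ˢ U)
      (𝓝 0) := by
    rw [Metric.tendsto_nhds]
    intro δ hδ
    set M : ℝ := 4 + 4 * (P + 1) with hM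
    have hMpos : 0 < M := by positivity
    obtain ⟨s, C, hsC⟩ := hcpt (δ / (2 * M)) (by positivity)
    have hsum : Tendsto (fun p : ℕ × ℕ => C * ∑ l ∈ s, ‖l ((f p.1).1 - (f p.2).1)‖ ^ 2)
        ((U : Filter ℕ) ×ˢ U) (𝓝 0) := by
      simpa using (tendsto_finsetSum s fun l _ => hl' l).const_mul C
    filter_upwards [hsum.eventually (gt_mem_nhds (half_pos hδ))] with p hp
    have h := hsC _ (K.sub_mem (hfK p.1) (hfK p.2))
    simp only [Prod.fst_sub, Prod.snd_sub] at h
    have b1 : ‖(f p.1).1 - (f p.2).1‖ ^ 2 ≤ 4 := by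
      have := norm_sub_le (f p.1).1 (f p.2).1
      rw [hf1, hf1] at this
      nlinarith [norm_nonneg ((f p.1).1 - (f p.2).1)]
    have b2 : ‖(f p.1).2 - (f p.2).2‖ ^ 2 ≤ 4 * (P + 1) := by
      have := parallelogram_law_with_norm ℂ (f p.1).2 (f p.2).2
      nlinarith [hbdd p.1, hbdd p.2, mul_self_nonneg ‖(f p.1).2 + (f p.2).2‖]
    have b3 : δ / (2 * M) * (‖(f p.1).1 - (f p.2).1‖ ^ 2 + ‖(f p.1).2 - (f p.2).2‖ ^ 2)
        ≤ δ / 2 := by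
      calc _ ≤ δ / (2 * M) * M := by gcongr; linarith
        _ = δ / 2 := by field_simp
    rw [Real.dist_eq, sub_zero, abs_of_nonneg (sq_nonneg _)]
    linarith
  have hc2 : Tendsto (fun p : ℕ × ℕ => ‖(f p.1).2 - (f p.2).2‖ ^ 2) ((U : Filter ℕ) ×ˢ U)
      (𝓝 0) := by
    -- By the parallelogram law and minimality at the sum of two terms, this expression dominates
    -- ‖(f p.1).2 - (f p.2).2‖², and its limit is 4P - 4P = 0.
    have hlim : Tendsto (fun p : ℕ × ℕ => 2 * ‖(f p.1).2‖ ^ 2 + 2 * ‖(f p.2).2‖ ^ 2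
        - P * (4 - ‖(f p.1).1 - (f p.2).1‖ ^ 2)) ((U : Filter ℕ) ×ˢ U) (𝓝 0) := by
      have := (((hPlim.comp tendsto_fst).const_mul 2).add
        ((hPlim.comp (tendsto_snd (f := (U : Filter ℕ)))).const_mul 2)).sub
          ((hc1.const_sub 4).const_mul P)
      have e : 2 * P + 2 * P - P * (4 - 0) = 0 := by ring
      rw [e] at this
      exact this
    refine tendsto_of_tendsto_of_tendsto_of_le_of_le tendsto_const_nhds hlim
      (fun _ => sq_nonneg _) ?_
    intro p
    have e1 := parallelogram_law_with_norm ℂ (f p.1).1 (f p.2).1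
    have e2 := parallelogram_law_with_norm ℂ (f p.1).2 (f p.2).2
    have h := hmin _ (K.add_mem (hfK p.1) (hfK p.2))
    simp only [Prod.fst_add, Prod.snd_add] at h
    rw [hf1, hf1] at e1
    have e1' : ‖(f p.1).1 + (f p.2).1‖ ^ 2 = 4 - ‖(f p.1).1 - (f p.2).1‖ ^ 2 := by linarith
    rw [e1'] at h
    show _ ≤ _
    linarith
  obtain ⟨w1, hw1⟩ := exists_tendsto_of_tendsto_norm_sub_sq (g := fun n => (f n).1) hc1
  obtain ⟨w2, hw2⟩ := exists_tendsto_of_tendsto_norm_sub_sq (g := fun n => (f n).2) hc2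
  have hwK : (w1, w2) ∈ K :=
    hK.mem_of_tendsto (hw1.prodMk_nhds hw2) (Eventually.of_forall fun n => hfK n)
  have hn1 : ‖w1‖ = 1 := tendsto_nhds_unique hw1.norm (by simp [hf1])
  have hn2 : ‖w2‖ ^ 2 = P := tendsto_nhds_unique (hw2.norm.pow 2) hPlim
  refine ⟨P, (w1, w2), hwK, ?_, hmin, fun v hv => inner_eq_of_isMin hwK hmin ?_ hv⟩
  · intro h
    simp only at h
    simp [h] at hn1
  · simp [hn1, hn2]

end Minimizer

/-! ### Algebra of the Lamé operator and of the elastic energy. -/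

section Algebra

theorem sum_moduli (lam mu : ℝ) (T : Fin 3 → Fin 3 → Fin 3 → Fin 3 → ℂ) :
    ∑ i, ∑ j, ∑ k, ∑ l, (moduli lam mu i j k l : ℂ) * T i j k l
      = lam * ∑ i, ∑ k, T i i k k + mu * (∑ i, ∑ j, T i j i j + ∑ i, ∑ j, T i j j i) := by
  have h : ∀ i j k l, (moduli lam mu i j k l : ℂ) * T i j k l
      = (if i = j then (if k = l then (lam : ℂ) * T i j k l else 0) else 0)
        + (if i = k then (if j = l then (mu : ℂ) * T i j k l else 0) else 0)
        + (if i = l then (if j = k then (mu : ℂ) * T i j k l else 0) else 0) := by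
    intro i j k l
    simp only [moduli, kron]
    split_ifs <;> push_cast <;> ring
  simp only [h, Finset.sum_add_distrib, Finset.mul_sum, mul_add]
  have d1 : ∑ i, ∑ j, ∑ k, ∑ l, (if i = j then (if k = l then (lam : ℂ) * T i j k l else 0) else 0)
      = ∑ i, ∑ k, (lam : ℂ) * T i i k k := by
    refine Finset.sum_congr rfl fun i _ => ?_
    rw [Finset.sum_eq_single i (fun j _ hj => by simp [Ne.symm hj]) (by simp)]
    simp
  have d2 : ∑ i, ∑ j, ∑ k, ∑ l, (if i = k then (if j = l then (mu : ℂ) * T i j k l else 0) else 0)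
      = ∑ i, ∑ j, (mu : ℂ) * T i j i j := by
    refine Finset.sum_congr rfl fun i _ => Finset.sum_congr rfl fun j _ => ?_
    rw [Finset.sum_eq_single i (fun k _ hk => by simp [Ne.symm hk]) (by simp)]
    simp
  have d3 : ∑ i, ∑ j, ∑ k, ∑ l, (if i = l then (if j = k then (mu : ℂ) * T i j k l else 0) else 0)
      = ∑ i, ∑ j, (mu : ℂ) * T i j j i := by
    refine Finset.sum_congr rfl fun i _ => Finset.sum_congr rfl fun j _ => ?_
    rw [Finset.sum_eq_single j (fun k _ hk => by simp [Ne.symm hk]) (by simp)]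
    simp
  rw [d1, d2, d3]
  ring

variable {E : Type*} [NormedAddCommGroup E] [InnerProductSpace ℂ E]

theorem inner_self_eq_ofReal (x : E) : inner ℂ x x = ((‖x‖ ^ 2 : ℝ) : ℂ) := by
  rw [inner_self_eq_norm_sq_to_K]; norm_cast

theorem inner_sum_sum (x y : Fin 3 → E) :
    inner ℂ (∑ j, x j) (∑ k, y k) = ∑ j, ∑ k, inner ℂ (x j) (y k) := by
  rw [sum_inner]
  simp only [inner_sum]

/-- The elastic energy of a gradient field whose components can be swapped by integration by
parts. -/
theorem sum_moduli_inner (lam mu : ℝ) {g : Fin 3 → Fin 3 → E}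
    (hg : ∀ a b i j, inner ℂ (g a i) (g b j) = inner ℂ (g a j) (g b i)) :
    ∑ i, ∑ j, ∑ k, ∑ l, (moduli lam mu i j k l : ℂ) * inner ℂ (g k l) (g i j)
      = ((mu * ∑ a, ∑ i, ‖g a i‖ ^ 2 + (lam + mu) * ‖∑ i, g i i‖ ^ 2 : ℝ) : ℂ) := by
  rw [sum_moduli lam mu fun i j k l => inner ℂ (g k l) (g i j)]
  have e1 : ∑ i, ∑ k, inner ℂ (g k k) (g i i) = ((‖∑ i, g i i‖ ^ 2 : ℝ) : ℂ) := by
    rw [← inner_self_eq_ofReal, inner_sum]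
    simp only [sum_inner]
  -- The pairing of the gradient with its transpose becomes ‖div u‖², so the energy controls the
  -- whole gradient without Korn's inequality.
  have e2 : ∑ i, ∑ j, inner ℂ (g j i) (g i j) = ((‖∑ i, g i i‖ ^ 2 : ℝ) : ℂ) := by
    rw [← e1]
    exact Finset.sum_congr rfl fun i _ => Finset.sum_congr rfl fun j _ => hg _ _ _ _
  rw [e1, e2]
  simp only [inner_self_eq_ofReal]
  push_cast
  ring

/-- The Lamé operator tested against the field itself gives minus the elastic energy. -/
theorem sum_inner_lame (lam mu : ℝ) {f : Fin 3 → E} {g : Fin 3 → Fin 3 → E}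
    {H : Fin 3 → Fin 3 → Fin 3 → E}
    (hH : ∀ a b i j, inner ℂ (f b) (H a i j) = -inner ℂ (g b i) (g a j)) :
    ∑ a, inner ℂ (f a) ((mu : ℂ) • ∑ j, H a j j + ((lam + mu : ℝ) : ℂ) • ∑ j, H j a j)
      = -((mu * ∑ a, ∑ i, ‖g a i‖ ^ 2 + (lam + mu) * ‖∑ i, g i i‖ ^ 2 : ℝ) : ℂ) := by
  have e1 : ∑ i, ∑ k, inner ℂ (g i i) (g k k) = ((‖∑ i, g i i‖ ^ 2 : ℝ) : ℂ) := by
    rw [← inner_self_eq_ofReal, sum_inner]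
    simp only [inner_sum]
  simp only [inner_add_right, inner_smul_right, inner_sum, hH, Finset.sum_add_distrib,
    ← Finset.mul_sum, Finset.sum_neg_distrib, inner_self_eq_ofReal, e1]
  push_cast
  ring

/-- The Lamé operator controls all second derivatives. -/
theorem sum_norm_sq_lame_ge {lam mu : ℝ} (hmu : 0 < mu) (hlm : 0 < lam + mu)
    {H : Fin 3 → Fin 3 → Fin 3 → E} (hs : ∀ a i j, H a i j = H a j i)
    (hH : ∀ a b i j k l, inner ℂ (H a i j) (H b k l) = inner ℂ (H a k j) (H b i l)) :
    mu ^ 2 * ∑ a, ∑ i, ∑ j, ‖H a i j‖ ^ 2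
      ≤ ∑ a, ‖(mu : ℂ) • ∑ j, H a j j + ((lam + mu : ℝ) : ℂ) • ∑ j, H j a j‖ ^ 2 := by
  -- This is ⟨Δu, ∇div u⟩ = ‖∇div u‖²: the cross term of the Lamé operator has a sign and can be
  -- dropped when λ+μ > 0.
  have e1 : ∑ a, inner ℂ (∑ j, H a j j) (∑ j, H j a j) = ((∑ a, ‖∑ j, H j a j‖ ^ 2 : ℝ) : ℂ) := by
    push_cast
    have : ∀ a, ((‖∑ j, H j a j‖ : ℝ) : ℂ) ^ 2 = inner ℂ (∑ j, H j a j) (∑ j, H j a j) := by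
      intro a; rw [inner_self_eq_ofReal]; norm_cast
    simp only [this, inner_sum_sum]
    rw [Finset.sum_comm]
    refine Finset.sum_congr rfl fun j _ => Finset.sum_congr rfl fun a _ =>
      Finset.sum_congr rfl fun k _ => ?_
    rw [hH, hs a a j]
  -- For compactly supported fields the Laplacian has the same norm as the full Hessian.
  have e2 : ∀ a, ‖∑ j, H a j j‖ ^ 2 = ∑ i, ∑ j, ‖H a i j‖ ^ 2 := by
    intro a
    have : ((‖∑ j, H a j j‖ ^ 2 : ℝ) : ℂ) = ((∑ i, ∑ j, ‖H a i j‖ ^ 2 : ℝ) : ℂ) := by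
      rw [← inner_self_eq_ofReal]
      push_cast
      have : ∀ i j, ((‖H a i j‖ : ℝ) : ℂ) ^ 2 = inner ℂ (H a i j) (H a i j) := by
        intro i j; rw [inner_self_eq_ofReal]; norm_cast
      simp only [this, sum_inner, inner_sum]
      refine Finset.sum_congr rfl fun j _ => Finset.sum_congr rfl fun i _ => ?_
      rw [hH, hs a i j]
    exact_mod_cast this
  have e3 : ∀ x y : E, ‖(mu : ℂ) • x + ((lam + mu : ℝ) : ℂ) • y‖ ^ 2 = mu ^ 2 * ‖x‖ ^ 2
      + 2 * mu * (lam + mu) * (inner ℂ x y).re + (lam + mu) ^ 2 * ‖y‖ ^ 2 := by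
    intro x y
    rw [@norm_add_sq ℂ]
    simp only [inner_smul_left, inner_smul_right, norm_smul, Complex.conj_ofReal, Complex.norm_real,
      mul_pow, Real.norm_eq_abs, sq_abs, RCLike.re_to_complex, Complex.re_ofReal_mul]
    ring
  have e4 : ∑ a, (inner ℂ (∑ j, H a j j) (∑ j, H j a j)).re = ∑ a, ‖∑ j, H j a j‖ ^ 2 := by
    rw [← Complex.re_sum, e1, Complex.ofReal_re]
  simp only [e3, Finset.sum_add_distrib, ← Finset.mul_sum, e4, e2]
  have : 0 ≤ ∑ a, ‖∑ j, H j a j‖ ^ 2 := Finset.sum_nonneg fun _ _ => sq_nonneg _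
  have h1 : 0 ≤ 2 * mu * (lam + mu) * ∑ a, ‖∑ j, H j a j‖ ^ 2 := by positivity
  have h2 : 0 ≤ (lam + mu) ^ 2 * ∑ a, ‖∑ j, H j a j‖ ^ 2 := by positivity
  linarith

/-- Spectral estimate `(κ - a)(κ - b) ≥ (1 - a/K)(1 - b/K) κ²` for `κ ≥ K`, in the form needed for
quadratic forms. -/
theorem quadratic_lower_bound {a b K X D N : ℝ} (hK : 0 < K) (ha : 0 ≤ a) (haK : a ≤ K)
    (hb : 0 ≤ b) (hbK : b ≤ K) (hD : K * N ≤ D) (hX : 0 ≤ X - 2 * K * D + K ^ 2 * N) :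
    (1 - a / K) * (1 - b / K) * X ≤ X - (a + b) * D + a * b * N := by
  obtain ⟨s, rfl⟩ : ∃ s, a = s * K := ⟨a / K, by field_simp⟩
  obtain ⟨t, rfl⟩ : ∃ t, b = t * K := ⟨b / K, by field_simp⟩
  have hs : 0 ≤ s := by by_contra h; nlinarith
  have ht : 0 ≤ t := by by_contra h; nlinarith
  have hs1 : s ≤ 1 := by by_contra h; nlinarith
  have ht1 : t ≤ 1 := by by_contra h; nlinarith
  rw [mul_div_cancel_right₀ _ hK.ne', mul_div_cancel_right₀ _ hK.ne']
  have hc : 0 ≤ s + t - s * t := by nlinarith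
  have hc' : 0 ≤ (s * (1 - t) + t * (1 - s)) * K := by
    have h1 := mul_nonneg hs (sub_nonneg.2 ht1)
    have h2 := mul_nonneg ht (sub_nonneg.2 hs1)
    positivity
  -- With a = sK and b = tK, the difference of the two sides is exactly the sum of the products in
  -- `p1` and `p2`.
  have p1 := mul_nonneg hc hX
  have p2 := mul_nonneg hc' (sub_nonneg.2 hD)
  nlinarith

end Algebra

/-! ### Calculus of test functions. -/

section TestFunctions

variable {Ω : Set E3} {φ ψ : E3 → ℂ}

theorem classicalPartial_tsupport_subset (i : Fin 3) (φ : E3 → ℂ) :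
    tsupport (classicalPartial i φ) ⊆ tsupport φ :=
  tsupport_fderiv_apply_subset ℝ (EuclideanSpace.single i (1 : ℝ))

theorem IsTestFunction.partial (h : IsTestFunction Ω φ) (i : Fin 3) :
    IsTestFunction Ω (classicalPartial i φ) := by
  refine ⟨?_, h.2.1.mono' ?_, (classicalPartial_tsupport_subset i φ).trans h.2.2⟩
  · exact (h.1.fderiv_right (m := (⊤ : ℕ∞)) le_rfl).clm_apply contDiff_const
  · exact (subset_tsupport _).trans (classicalPartial_tsupport_subset i φ)

theorem IsTestFunction.differentiable (h : IsTestFunction Ω φ) : Differentiable ℝ φ :=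
  h.1.differentiable (by simp)

theorem IsTestFunction.continuous (h : IsTestFunction Ω φ) : Continuous φ := h.1.continuous

theorem IsTestFunction.add (hφ : IsTestFunction Ω φ) (hψ : IsTestFunction Ω ψ) :
    IsTestFunction Ω (φ + ψ) :=
  ⟨hφ.1.add hψ.1, hφ.2.1.add hψ.2.1,
    (tsupport_add φ ψ).trans (Set.union_subset hφ.2.2 hψ.2.2)⟩

theorem IsTestFunction.const_smul (c : ℂ) (hφ : IsTestFunction Ω φ) :
    IsTestFunction Ω (c • φ) :=
  ⟨contDiff_const.smul hφ.1, hφ.2.1.smul_left (f := fun _ => c),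
    (tsupport_smul_subset_right (fun _ => c) φ).trans hφ.2.2⟩

theorem IsTestFunction.conj (hφ : IsTestFunction Ω φ) :
    IsTestFunction Ω (fun x => conj (φ x)) := by
  have hs : tsupport (fun x => (starRingEnd ℂ) (φ x)) ⊆ tsupport φ := by
    refine closure_mono fun x hx => ?_
    simpa using hx
  exact ⟨Complex.conjCLE.contDiff.comp hφ.1, hφ.2.1.mono' ((subset_tsupport _).trans hs),
    hs.trans hφ.2.2⟩

theorem isTestFunction_zero : IsTestFunction Ω (0 : E3 → ℂ) :=
  ⟨contDiff_const, HasCompactSupport.zero, by simp [tsupport]⟩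

theorem classicalPartial_add (hφ : IsTestFunction Ω φ) (hψ : IsTestFunction Ω ψ) (i : Fin 3) :
    classicalPartial i (φ + ψ) = classicalPartial i φ + classicalPartial i ψ := by
  ext x
  simp only [classicalPartial, Pi.add_apply]
  rw [fderiv_add (hφ.differentiable x) (hψ.differentiable x)]
  rfl

theorem classicalPartial_smul (c : ℂ) (hφ : IsTestFunction Ω φ) (i : Fin 3) :
    classicalPartial i (c • φ) = c • classicalPartial i φ := by
  ext x
  simp only [classicalPartial, Pi.smul_apply]
  rw [fderiv_const_smul (hφ.differentiable x)]
  rfl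

theorem classicalPartial_conj (hφ : IsTestFunction Ω φ) (i : Fin 3) (x : E3) :
    classicalPartial i (fun y => conj (φ y)) x = conj (classicalPartial i φ x) := by
  have h := (Complex.conjCLE.toContinuousLinearMap.hasFDerivAt (x := φ x)).comp x
    (hφ.differentiable x).hasFDerivAt
  have h' : HasFDerivAt (fun y => (starRingEnd ℂ) (φ y))
      (Complex.conjCLE.toContinuousLinearMap.comp (fderiv ℝ φ x)) x := h
  simp only [classicalPartial]
  rw [h'.fderiv]
  simp

theorem classicalPartial_comm (hφ : IsTestFunction Ω φ) (i j : Fin 3) :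
    classicalPartial i (classicalPartial j φ) = classicalPartial j (classicalPartial i φ) := by
  ext x
  have hd : Differentiable ℝ (fderiv ℝ φ) :=
    (hφ.1.fderiv_right (m := (⊤ : ℕ∞)) le_rfl).differentiable (by simp)
  have hsymm : IsSymmSndFDerivAt ℝ φ x :=
    (hφ.1.contDiffAt).isSymmSndFDerivAt (by
      simp only [minSmoothness_of_isRCLikeNormedField]
      exact WithTop.coe_le_coe.2 (le_top : (2 : ℕ∞) ≤ ⊤))
  have key : ∀ a b : Fin 3, classicalPartial a (classicalPartial b φ) x
      = fderiv ℝ (fderiv ℝ φ) x (EuclideanSpace.single a 1) (EuclideanSpace.single b 1) := by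
    intro a b
    have : HasFDerivAt (fun y => fderiv ℝ φ y (EuclideanSpace.single b (1 : ℝ)))
        ((fderiv ℝ (fderiv ℝ φ) x).flip (EuclideanSpace.single b 1)) x := by
      simpa using (hd x).hasFDerivAt.clm_apply
        (hasFDerivAt_const (EuclideanSpace.single b (1 : ℝ) : E3) x)
    unfold classicalPartial
    rw [this.fderiv]
    rfl
  rw [key, key]
  exact hsymm _ _

theorem IsTestFunction.memL2 (h : IsTestFunction Ω φ) : MemL2 Ω φ :=
  (h.continuous.memLp_of_hasCompactSupport h.2.1).restrict Ω

theorem IsTestFunction.eq_zero_of_notMem (h : IsTestFunction Ω φ) {x : E3} (hx : x ∉ Ω) :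
    φ x = 0 :=
  image_eq_zero_of_notMem_tsupport fun hx' => hx (h.2.2 hx')

/-- Integration by parts for test functions. -/
theorem integral_mul_classicalPartial (hφ : IsTestFunction Ω φ) (hψ : IsTestFunction Ω ψ)
    (i : Fin 3) :
    ∫ x in Ω, φ x * classicalPartial i ψ x = -∫ x in Ω, classicalPartial i φ x * ψ x := by
  have hz : ∀ {f g : E3 → ℂ}, IsTestFunction Ω g →
      ∫ x in Ω, f x * g x = ∫ x, f x * g x := fun hg =>
    setIntegral_eq_integral_of_forall_compl_eq_zero fun x hx => by
      rw [hg.eq_zero_of_notMem hx, mul_zero]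
  rw [hz (hψ.partial i), hz hψ]
  have hint : ∀ {f g : E3 → ℂ}, IsTestFunction Ω f → IsTestFunction Ω g →
      Integrable (fun x => f x * g x) volume := fun hf hg =>
    (hf.continuous.mul hg.continuous).integrable_of_hasCompactSupport hg.2.1.mul_left
  exact integral_mul_fderiv_eq_neg_fderiv_mul_of_integrable (hint (hφ.partial i) hψ)
    (hint hφ (hψ.partial i)) (hint hφ hψ) (fun x _ => hφ.differentiable x)
    (fun x _ => hψ.differentiable x)

end TestFunctions

/-! ### Passage from functions to classes in L²(Ω). -/

section L2Class

/-- The Hilbert space `L²(Ω)` of classes of functions. -/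
abbrev L2Space (Ω : Set E3) : Type := Lp ℂ 2 (volume.restrict Ω)

open Classical in
/-- The class of `u` in `L²(Ω)`, and `0` if `u` is not square integrable. -/
def l2Class (Ω : Set E3) (u : E3 → ℂ) : L2Space Ω :=
  if h : MemLp u 2 (volume.restrict Ω) then h.toLp u else 0

variable {Ω : Set E3} {u v g : E3 → ℂ}

theorem MemL2.l2Class_ae_eq (h : MemL2 Ω u) : l2Class Ω u =ᵐ[volume.restrict Ω] u := by
  have h' : MemLp u 2 (volume.restrict Ω) := h
  rw [l2Class, dif_pos h']
  exact h'.coeFn_toLp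

theorem memL2_coe (f : L2Space Ω) : MemL2 Ω f := Lp.memLp f

theorem l2Class_coe (f : L2Space Ω) : l2Class Ω f = f :=
  Lp.ext (memL2_coe f).l2Class_ae_eq

theorem l2Class_congr (h : u =ᵐ[volume.restrict Ω] v) : l2Class Ω u = l2Class Ω v := by
  by_cases hu : MemLp u 2 (volume.restrict Ω)
  · have hv : MemL2 Ω v := hu.ae_eq h
    have hu : MemL2 Ω u := hu
    exact Lp.ext (hu.l2Class_ae_eq.trans (h.trans hv.l2Class_ae_eq.symm))
  · have hv : ¬ MemLp v 2 (volume.restrict Ω) := fun hv => hu (hv.ae_eq h.symm)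
    rw [l2Class, l2Class, dif_neg hu, dif_neg hv]

theorem MemL2.ae_eq_of_l2Class_eq (hu : MemL2 Ω u) (hv : MemL2 Ω v)
    (h : l2Class Ω u = l2Class Ω v) : u =ᵐ[volume.restrict Ω] v :=
  hu.l2Class_ae_eq.symm.trans (h ▸ hv.l2Class_ae_eq)

theorem MemL2.add (hu : MemL2 Ω u) (hv : MemL2 Ω v) : MemL2 Ω (u + v) := MemLp.add hu hv

theorem MemL2.sub (hu : MemL2 Ω u) (hv : MemL2 Ω v) : MemL2 Ω (u - v) := MemLp.sub hu hv

theorem MemL2.const_smul (c : ℂ) (hu : MemL2 Ω u) : MemL2 Ω (c • u) := MemLp.const_smul hu c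

theorem l2Class_add (hu : MemL2 Ω u) (hv : MemL2 Ω v) :
    l2Class Ω (u + v) = l2Class Ω u + l2Class Ω v :=
  Lp.ext ((hu.add hv).l2Class_ae_eq.trans ((hu.l2Class_ae_eq.add hv.l2Class_ae_eq).symm.trans
    (Lp.coeFn_add _ _).symm))

theorem l2Class_sub (hu : MemL2 Ω u) (hv : MemL2 Ω v) :
    l2Class Ω (u - v) = l2Class Ω u - l2Class Ω v :=
  Lp.ext ((hu.sub hv).l2Class_ae_eq.trans ((hu.l2Class_ae_eq.sub hv.l2Class_ae_eq).symm.trans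
    (Lp.coeFn_sub _ _).symm))

theorem l2Class_smul (c : ℂ) (hu : MemL2 Ω u) : l2Class Ω (c • u) = c • l2Class Ω u :=
  Lp.ext ((hu.const_smul c).l2Class_ae_eq.trans ((hu.l2Class_ae_eq.const_smul c).symm.trans
    (Lp.coeFn_smul _ _).symm))

theorem inner_l2Class (hu : MemL2 Ω u) (hv : MemL2 Ω v) :
    inner ℂ (l2Class Ω u) (l2Class Ω v) = ∫ x in Ω, v x * conj (u x) := by
  rw [L2.inner_def]
  refine integral_congr_ae ?_
  filter_upwards [hu.l2Class_ae_eq, hv.l2Class_ae_eq] with x h1 h2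
  rw [h1, h2]
  rfl

theorem integrable_mul_conj (hu : MemL2 Ω u) (hv : MemL2 Ω v) :
    Integrable (fun x => v x * conj (u x)) (volume.restrict Ω) := by
  have h := L2.integrable_inner (𝕜 := ℂ) (l2Class Ω u) (l2Class Ω v)
  refine h.congr ?_
  filter_upwards [hu.l2Class_ae_eq, hv.l2Class_ae_eq] with x h1 h2
  rw [h1, h2]
  rfl

theorem norm_sq_l2Class (hu : MemL2 Ω u) : ‖l2Class Ω u‖ ^ 2 = l2NormSq Ω u := by
  have h1 : (((‖l2Class Ω u‖ ^ 2 : ℝ)) : ℂ) = ((l2NormSq Ω u : ℝ) : ℂ) := by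
    rw [← inner_self_eq_ofReal, inner_l2Class hu hu, l2NormSq, ← integral_complex_ofReal]
    refine integral_congr_ae (ae_of_all _ fun x => ?_)
    simp only [Complex.mul_conj, Complex.normSq_eq_norm_sq]
  exact_mod_cast h1

end L2Class

/-! ### Weak derivatives as identities in L²(Ω). -/

section WeakDerivative

variable {Ω : Set E3} {u v g k : E3 → ℂ} {i : Fin 3}

theorem MemL2.integrableOn (hb : Bornology.IsBounded Ω) (hu : MemL2 Ω u) :
    IntegrableOn u Ω volume := by
  have : IsFiniteMeasure (volume.restrict Ω) := ⟨by
    rw [Measure.restrict_apply_univ]; exact hb.measure_lt_top⟩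
  exact MemLp.integrable (by norm_num) hu

/-- For square integrable functions, weak differentiability can be tested in `L²(Ω)`. -/
theorem hasWeakPartial_iff (hb : Bornology.IsBounded Ω) (hu : MemL2 Ω u) (hg : MemL2 Ω g) :
    HasWeakPartial Ω i u g ↔ ∀ φ, IsTestFunction Ω φ →
      inner ℂ (l2Class Ω (classicalPartial i φ)) (l2Class Ω u)
        = -inner ℂ (l2Class Ω φ) (l2Class Ω g) := by
  have e1 : ∀ {f φ : E3 → ℂ}, MemL2 Ω f → IsTestFunction Ω φ →
      inner ℂ (l2Class Ω φ) (l2Class Ω f) = ∫ x in Ω, f x * conj (φ x) :=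
    fun hf hφ => inner_l2Class hφ.memL2 hf
  constructor
  · rintro ⟨-, -, h⟩ φ hφ
    rw [e1 hu (hφ.partial i), e1 hg hφ, ← h _ hφ.conj]
    simp only [classicalPartial_conj hφ]
  · intro h
    refine ⟨(hu.integrableOn hb).locallyIntegrableOn, (hg.integrableOn hb).locallyIntegrableOn,
      fun φ hφ => ?_⟩
    have := h _ hφ.conj
    rw [e1 hu (hφ.conj.partial i), e1 hg hφ.conj] at this
    simpa only [classicalPartial_conj hφ, Complex.conj_conj] using this

theorem inner_classicalPartial {φ ψ : E3 → ℂ} (hφ : IsTestFunction Ω φ) (hψ : IsTestFunction Ω ψ)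
    (i : Fin 3) :
    inner ℂ (l2Class Ω (classicalPartial i φ)) (l2Class Ω ψ)
      = -inner ℂ (l2Class Ω φ) (l2Class Ω (classicalPartial i ψ)) := by
  rw [inner_l2Class (hφ.partial i).memL2 hψ.memL2, inner_l2Class hφ.memL2 (hψ.partial i).memL2]
  have := integral_mul_classicalPartial hψ hφ.conj i
  simpa only [classicalPartial_conj hφ] using this

theorem IsTestFunction.hasWeakPartial (hb : Bornology.IsBounded Ω) {φ : E3 → ℂ}
    (hφ : IsTestFunction Ω φ) (i : Fin 3) : HasWeakPartial Ω i φ (classicalPartial i φ) :=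
  (hasWeakPartial_iff hb hφ.memL2 (hφ.partial i).memL2).2 fun _ hψ =>
    inner_classicalPartial hψ hφ i

theorem HasWeakPartial.congr_left (h : HasWeakPartial Ω i u g)
    (huv : u =ᵐ[volume.restrict Ω] v) (hb : Bornology.IsBounded Ω) (hu : MemL2 Ω u)
    (hg : MemL2 Ω g) : HasWeakPartial Ω i v g := by
  rw [hasWeakPartial_iff hb (MemLp.ae_eq huv hu) hg, ← l2Class_congr huv]
  exact (hasWeakPartial_iff hb hu hg).1 h

/-- The fundamental lemma of the calculus of variations; real test functions suffice. It makes the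
arbitrary choice in `weakPartial` harmless up to null sets. -/
theorem HasWeakPartial.unique (ho : IsOpen Ω) (hg : HasWeakPartial Ω i u g)
    (hk : HasWeakPartial Ω i u k) : g =ᵐ[volume.restrict Ω] k := by
  have hloc : LocallyIntegrableOn (g - k) Ω volume := hg.2.1.sub hk.2.1
  have h := IsOpen.ae_eq_zero_of_integral_contDiff_smul_eq_zero ho hloc (by
    intro η hη hηc hηΩ
    have hs : tsupport (fun x => (η x : ℂ)) ⊆ tsupport η := by
      refine closure_mono fun x hx => ?_
      simpa using hx
    have hφ : IsTestFunction Ω (fun x => (η x : ℂ)) :=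
      ⟨Complex.ofRealCLM.contDiff.comp hη, hηc.mono' ((subset_tsupport _).trans hs),
        hs.trans hηΩ⟩
    have key : ∫ x in Ω, g x * (η x : ℂ) = ∫ x in Ω, k x * (η x : ℂ) := by
      have h1 := hg.2.2 _ hφ
      have h2 := hk.2.2 _ hφ
      rw [h1] at h2
      exact neg_injective h2
    have hint : ∀ {f : E3 → ℂ}, LocallyIntegrableOn f Ω volume →
        IntegrableOn (fun x => f x * (η x : ℂ)) Ω volume := by
      intro f hf
      have hK : IntegrableOn f (tsupport η) volume := hf.integrableOn_compact_subset hηΩ hηc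
      have : IntegrableOn (fun x => f x * (η x : ℂ)) (tsupport η) volume :=
        hK.mul_continuousOn hφ.continuous.continuousOn hηc
      have hall : Integrable (fun x => f x * (η x : ℂ)) volume :=
        (integrableOn_iff_integrable_of_support_subset (fun x hx => by
          by_contra hx'
          exact hx (by simp [image_eq_zero_of_notMem_tsupport hx']))).1 this
      exact hall.integrableOn
    rw [← setIntegral_eq_integral_of_forall_compl_eq_zero (s := Ω) (fun x hx => by
      rw [image_eq_zero_of_notMem_tsupport fun hx' => hx (hηΩ hx'), zero_smul])]
    have e : ∀ x, η x • (g - k) x = g x * (η x : ℂ) - k x * (η x : ℂ) := by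
      intro x
      simp only [Pi.sub_apply, Complex.real_smul]
      ring
    simp only [e]
    rw [integral_sub (hint hg.2.1) (hint hk.2.1), key, sub_self])
  have h' := (ae_restrict_iff' ho.measurableSet).2 h
  filter_upwards [h'] with x hx
  exact sub_eq_zero.1 hx

theorem HasWeakPartial.weakPartial (h : HasWeakPartial Ω i u g) :
    HasWeakPartial Ω i u (weakPartial Ω i u) := by
  have hex : ∃ g, HasWeakPartial Ω i u g := ⟨g, h⟩
  rw [ElasticITP.weakPartial, dif_pos hex]
  exact hex.choose_spec

theorem HasWeakPartial.weakPartial_ae_eq (ho : IsOpen Ω) (h : HasWeakPartial Ω i u g) :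
    ElasticITP.weakPartial Ω i u =ᵐ[volume.restrict Ω] g :=
  h.weakPartial.unique ho h

theorem MemH1.hasWeakPartial (h : MemH1 Ω u) (i : Fin 3) :
    HasWeakPartial Ω i u (weakPartial Ω i u) :=
  let ⟨_, _, hg⟩ := h.2 i
  hg.weakPartial

theorem MemH1.memL2_weakPartial (ho : IsOpen Ω) (h : MemH1 Ω u) (i : Fin 3) :
    MemL2 Ω (weakPartial Ω i u) :=
  let ⟨_, hgL, hg⟩ := h.2 i
  MemLp.ae_eq (hg.weakPartial_ae_eq ho).symm hgL

theorem HasWeakPartial.sub (hb : Bornology.IsBounded Ω) (hu : MemL2 Ω u) (hv : MemL2 Ω v)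
    (hg : MemL2 Ω g) (hk : MemL2 Ω k) (h1 : HasWeakPartial Ω i u g)
    (h2 : HasWeakPartial Ω i v k) : HasWeakPartial Ω i (u - v) (g - k) := by
  rw [hasWeakPartial_iff hb (hu.sub hv) (hg.sub hk)]
  intro φ hφ
  rw [l2Class_sub hu hv, l2Class_sub hg hk, inner_sub_right, inner_sub_right,
    (hasWeakPartial_iff hb hu hg).1 h1 φ hφ, (hasWeakPartial_iff hb hv hk).1 h2 φ hφ]
  ring

theorem MemH1.sub_test (hb : Bornology.IsBounded Ω) (ho : IsOpen Ω) (hu : MemH1 Ω u)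
    {φ : E3 → ℂ} (hφ : IsTestFunction Ω φ) (i : Fin 3) :
    weakPartial Ω i (u - φ)
      =ᵐ[volume.restrict Ω] weakPartial Ω i u - classicalPartial i φ :=
  ((hu.hasWeakPartial i).sub hb hu.1 hφ.memL2 (hu.memL2_weakPartial ho i) (hφ.partial i).memL2
    (hφ.hasWeakPartial hb i)).weakPartial_ae_eq ho

end WeakDerivative

/-! ### Approximation of H¹₀ and H²₀ functions by test functions. -/

section Approximation

variable {Ω : Set E3} {u : E3 → ℂ}

theorem l2NormSq_congr {u v : E3 → ℂ} (h : u =ᵐ[volume.restrict Ω] v) :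
    l2NormSq Ω u = l2NormSq Ω v :=
  integral_congr_ae (by filter_upwards [h] with x hx; rw [hx])

theorem l2NormSq_nonneg (u : E3 → ℂ) : 0 ≤ l2NormSq Ω u :=
  integral_nonneg fun _ => sq_nonneg _

theorem l2NormSq_sub {u v : E3 → ℂ} (hu : MemL2 Ω u) (hv : MemL2 Ω v) :
    l2NormSq Ω (u - v) = ‖l2Class Ω v - l2Class Ω u‖ ^ 2 := by
  rw [← norm_sq_l2Class (hu.sub hv), l2Class_sub hu hv, norm_sub_rev]

theorem h1NormSq_sub_test (hb : Bornology.IsBounded Ω) (ho : IsOpen Ω) (hu : MemH1 Ω u)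
    {φ : E3 → ℂ} (hφ : IsTestFunction Ω φ) :
    h1NormSq Ω (u - φ) = ‖l2Class Ω φ - l2Class Ω u‖ ^ 2
      + ∑ i, ‖l2Class Ω (classicalPartial i φ) - l2Class Ω (weakPartial Ω i u)‖ ^ 2 := by
  rw [h1NormSq, l2NormSq_sub hu.1 hφ.memL2]
  congr 1
  refine Finset.sum_congr rfl fun i _ => ?_
  rw [l2NormSq_congr (hu.sub_test hb ho hφ i),
    l2NormSq_sub (hu.memL2_weakPartial ho i) (hφ.partial i).memL2]

theorem h2NormSq_sub_test (hb : Bornology.IsBounded Ω) (ho : IsOpen Ω) (hu : MemH2 Ω u)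
    {φ : E3 → ℂ} (hφ : IsTestFunction Ω φ) :
    h2NormSq Ω (u - φ) = ‖l2Class Ω φ - l2Class Ω u‖ ^ 2
      + ∑ i, ‖l2Class Ω (classicalPartial i φ) - l2Class Ω (weakPartial Ω i u)‖ ^ 2
      + ∑ i, ∑ j, ‖l2Class Ω (classicalPartial i (classicalPartial j φ))
          - l2Class Ω (weakPartial Ω i (weakPartial Ω j u))‖ ^ 2 := by
  have h1 := h1NormSq_sub_test hb ho hu.1 hφ
  rw [h1NormSq] at h1
  rw [h2NormSq, h1]
  congr 1
  refine Finset.sum_congr rfl fun i _ => Finset.sum_congr rfl fun j _ => ?_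
  have hm1 := hu.1.memL2_weakPartial ho j
  have hm2 := (hu.2 j).memL2_weakPartial ho i
  have hm3 := (hφ.partial j).memL2
  have hm4 := ((hφ.partial j).partial i).memL2
  have h2 : HasWeakPartial Ω i (weakPartial Ω j u - classicalPartial j φ)
      (weakPartial Ω i (weakPartial Ω j u) - classicalPartial i (classicalPartial j φ)) :=
    ((hu.2 j).hasWeakPartial i).sub hb hm1 hm3 hm2 hm4 ((hφ.partial j).hasWeakPartial hb i)
  -- The inner `weakPartial` of `u - φ` is an arbitrary representative, so it is first exchanged for
  -- the explicit difference, to which it is almost everywhere equal.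
  have h3 := (h2.congr_left (hu.1.sub_test hb ho hφ j).symm hb (hm1.sub hm3)
    (hm2.sub hm4)).weakPartial_ae_eq ho
  rw [l2NormSq_congr h3, l2NormSq_sub hm2 hm4]

theorem exists_seq_of_forall_exists {T : (E3 → ℂ) → Prop} {F : (E3 → ℂ) → ℝ}
    (hF0 : ∀ φ, T φ → 0 ≤ F φ) (h : ∀ ε : ℝ, 0 < ε → ∃ φ, T φ ∧ F φ < ε) :
    ∃ φ : ℕ → E3 → ℂ, (∀ n, T (φ n)) ∧ Tendsto (fun n => F (φ n)) atTop (𝓝 0) := by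
  have hs : ∀ n : ℕ, ∃ φ, T φ ∧ F φ < 1 / ((n : ℝ) + 1) := fun n => h _ (by positivity)
  choose φ hT hφ using hs
  exact ⟨φ, hT, tendsto_of_tendsto_of_tendsto_of_le_of_le tendsto_const_nhds
    tendsto_one_div_add_atTop_nhds_zero_nat (fun n => hF0 _ (hT n)) fun n => (hφ n).le⟩

theorem tendsto_of_norm_sub_sq_le {H : Type*} [NormedAddCommGroup H] {f : ℕ → H} {z : H}
    {b : ℕ → ℝ} (hb : Tendsto b atTop (𝓝 0)) (h : ∀ n, ‖f n - z‖ ^ 2 ≤ b n) :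
    Tendsto f atTop (𝓝 z) := by
  have h1 : Tendsto (fun n => ‖f n - z‖ ^ 2) atTop (𝓝 0) :=
    tendsto_of_tendsto_of_tendsto_of_le_of_le tendsto_const_nhds hb (fun _ => sq_nonneg _) h
  have := h1.sqrt
  rw [tendsto_iff_norm_sub_tendsto_zero]
  simpa [Real.sqrt_sq] using this

theorem MemH10.exists_seq (hb : Bornology.IsBounded Ω) (ho : IsOpen Ω) (hu : MemH10 Ω u) :
    ∃ φ : ℕ → E3 → ℂ, (∀ n, IsTestFunction Ω (φ n)) ∧
      Tendsto (fun n => l2Class Ω (φ n)) atTop (𝓝 (l2Class Ω u)) ∧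
      ∀ i, Tendsto (fun n => l2Class Ω (classicalPartial i (φ n))) atTop
        (𝓝 (l2Class Ω (weakPartial Ω i u))) := by
  have hnn : ∀ φ, IsTestFunction Ω φ → 0 ≤ h1NormSq Ω (u - φ) := fun φ hφ => by
    rw [h1NormSq_sub_test hb ho hu.1 hφ]; positivity
  obtain ⟨φ, hφ, hlim⟩ := exists_seq_of_forall_exists hnn hu.2
  refine ⟨φ, hφ, tendsto_of_norm_sub_sq_le hlim fun n => ?_,
    fun i => tendsto_of_norm_sub_sq_le hlim fun n => ?_⟩
  · rw [h1NormSq_sub_test hb ho hu.1 (hφ n)]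
    exact le_add_of_nonneg_right (by positivity)
  · rw [h1NormSq_sub_test hb ho hu.1 (hφ n)]
    have := Finset.single_le_sum (f := fun i => ‖l2Class Ω (classicalPartial i (φ n))
      - l2Class Ω (weakPartial Ω i u)‖ ^ 2) (fun _ _ => sq_nonneg _) (Finset.mem_univ i)
    exact this.trans (le_add_of_nonneg_left (by positivity))

theorem le_sum_of_nonneg {A : ℝ} {B : Fin 3 → ℝ} {C : Fin 3 → Fin 3 → ℝ} (hA : 0 ≤ A)
    (hB : ∀ i, 0 ≤ B i) (hC : ∀ i j, 0 ≤ C i j) :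
    A ≤ A + ∑ i, B i + ∑ i, ∑ j, C i j ∧ (∀ i, B i ≤ A + ∑ i, B i + ∑ i, ∑ j, C i j) ∧
      ∀ i j, C i j ≤ A + ∑ i, B i + ∑ i, ∑ j, C i j := by
  have hB' : 0 ≤ ∑ i, B i := Finset.sum_nonneg fun i _ => hB i
  have hC' : ∀ i, 0 ≤ ∑ j, C i j := fun i => Finset.sum_nonneg fun j _ => hC i j
  have hC'' : 0 ≤ ∑ i, ∑ j, C i j := Finset.sum_nonneg fun i _ => hC' i
  refine ⟨by linarith, fun i => ?_, fun i j => ?_⟩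
  · have := Finset.single_le_sum (fun i _ => hB i) (Finset.mem_univ i)
    linarith
  · have h1 := Finset.single_le_sum (fun j _ => hC i j) (Finset.mem_univ j)
    have h2 := Finset.single_le_sum (fun i _ => hC' i) (Finset.mem_univ i)
    linarith

/-- A single sequence approximates the function and all its derivatives up to order two in L², so
bilinear identities for test functions pass to H²₀ by continuity. -/
theorem MemH20.exists_seq (hb : Bornology.IsBounded Ω) (ho : IsOpen Ω) (hu : MemH20 Ω u) :
    ∃ φ : ℕ → E3 → ℂ, (∀ n, IsTestFunction Ω (φ n)) ∧
      Tendsto (fun n => l2Class Ω (φ n)) atTop (𝓝 (l2Class Ω u)) ∧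
      (∀ i, Tendsto (fun n => l2Class Ω (classicalPartial i (φ n))) atTop
        (𝓝 (l2Class Ω (weakPartial Ω i u)))) ∧
      ∀ i j, Tendsto (fun n => l2Class Ω (classicalPartial i (classicalPartial j (φ n)))) atTop
        (𝓝 (l2Class Ω (weakPartial Ω i (weakPartial Ω j u)))) := by
  have hnn : ∀ φ, IsTestFunction Ω φ → 0 ≤ h2NormSq Ω (u - φ) := fun φ hφ => by
    rw [h2NormSq_sub_test hb ho hu.1 hφ]; positivity
  obtain ⟨φ, hφ, hlim⟩ := exists_seq_of_forall_exists hnn hu.2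
  have key := fun n => le_sum_of_nonneg
    (A := ‖l2Class Ω (φ n) - l2Class Ω u‖ ^ 2)
    (B := fun i => ‖l2Class Ω (classicalPartial i (φ n)) - l2Class Ω (weakPartial Ω i u)‖ ^ 2)
    (C := fun i j => ‖l2Class Ω (classicalPartial i (classicalPartial j (φ n)))
      - l2Class Ω (weakPartial Ω i (weakPartial Ω j u))‖ ^ 2)
    (sq_nonneg _) (fun _ => sq_nonneg _) fun _ _ => sq_nonneg _
  have hrw := fun n => h2NormSq_sub_test hb ho hu.1 (hφ n)
  simp only [← hrw] at key
  exact ⟨φ, hφ, tendsto_of_norm_sub_sq_le hlim fun n => (key n).1,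
    fun i => tendsto_of_norm_sub_sq_le hlim fun n => (key n).2.1 i,
    fun i j => tendsto_of_norm_sub_sq_le hlim fun n => (key n).2.2 i j⟩

theorem MemH20.memH10 (h : MemH20 Ω u) : MemH10 Ω u := by
  refine ⟨h.1.1, fun ε hε => ?_⟩
  obtain ⟨φ, hφ, hlt⟩ := h.2 ε hε
  refine ⟨φ, hφ, lt_of_le_of_lt ?_ hlt⟩
  exact le_add_of_nonneg_right
    (Finset.sum_nonneg fun _ _ => Finset.sum_nonneg fun _ _ => l2NormSq_nonneg _)

end Approximation

/-! ### Rellich compactness by the Fourier transform. -/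

section Compactness

open scoped SchwartzMap FourierTransform LineDeriv

variable {Ω : Set E3} {φ : E3 → ℂ}

/-- A test function as a Schwartz function. -/
def IsTestFunction.toSchwartz (h : IsTestFunction Ω φ) : 𝓢(E3, ℂ) :=
  h.2.1.toSchwartzMap h.1

theorem IsTestFunction.toSchwartz_apply (h : IsTestFunction Ω φ) (x : E3) :
    h.toSchwartz x = φ x := rfl

theorem IsTestFunction.lineDeriv_toSchwartz (h : IsTestFunction Ω φ) (i : Fin 3) :
    ∂_{(EuclideanSpace.single i (1 : ℝ) : E3)} h.toSchwartz = (h.partial i).toSchwartz := by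
  ext x
  rw [SchwartzMap.lineDerivOp_apply_eq_fderiv]
  rfl

theorem IsTestFunction.integral_norm_sq_fourier (h : IsTestFunction Ω φ) :
    ∫ ξ, ‖𝓕 h.toSchwartz ξ‖ ^ 2 = l2NormSq Ω φ := by
  rw [SchwartzMap.integral_norm_sq_fourier, l2NormSq]
  exact (setIntegral_eq_integral_of_forall_compl_eq_zero fun x hx => by
    simp [h.toSchwartz_apply, h.eq_zero_of_notMem hx]).symm

theorem IsTestFunction.norm_fourier_partial (h : IsTestFunction Ω φ) (i : Fin 3) (ξ : E3) :
    ‖𝓕 (h.partial i).toSchwartz ξ‖ ^ 2 = (2 * Real.pi) ^ 2 * (ξ i ^ 2 * ‖𝓕 h.toSchwartz ξ‖ ^ 2) := by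
  have ht : (fun x : E3 => inner ℝ x (EuclideanSpace.single i (1 : ℝ))).HasTemperateGrowth := by
    fun_prop
  rw [← h.lineDeriv_toSchwartz, SchwartzMap.fourier_lineDerivOp_eq]
  simp only [smul_apply, SchwartzMap.smulLeftCLM_apply_apply ht, norm_smul]
  have e : inner ℝ ξ (EuclideanSpace.single i (1 : ℝ)) = ξ i := by
    simp [EuclideanSpace.inner_single_right]
  rw [e]
  simp [abs_of_pos Real.pi_pos, mul_pow]

theorem integrable_norm_sq_schwartz (s : 𝓢(E3, ℂ)) : Integrable fun x => ‖s x‖ ^ 2 :=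
  (memLp_two_iff_integrable_sq_norm s.continuous.aestronglyMeasurable).1 (s.memLp 2)

theorem IsTestFunction.integrable_norm_sq_mul (h : IsTestFunction Ω φ) :
    Integrable fun ξ : E3 => ‖ξ‖ ^ 2 * ‖𝓕 h.toSchwartz ξ‖ ^ 2 := by
  have := integrable_finsetSum Finset.univ fun i (_ : i ∈ Finset.univ) =>
    (integrable_norm_sq_schwartz (𝓕 (h.partial i).toSchwartz)).const_mul ((2 * Real.pi) ^ 2)⁻¹
  refine this.congr (ae_of_all _ fun ξ => ?_)
  simp only [h.norm_fourier_partial, EuclideanSpace.norm_sq_eq, Real.norm_eq_abs, sq_abs,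
    Finset.sum_mul]
  refine Finset.sum_congr rfl fun i _ => ?_
  have := Real.pi_pos
  field_simp

theorem IsTestFunction.integral_norm_sq_mul (h : IsTestFunction Ω φ) :
    (2 * Real.pi) ^ 2 * ∫ ξ : E3, ‖ξ‖ ^ 2 * ‖𝓕 h.toSchwartz ξ‖ ^ 2
      = ∑ i, l2NormSq Ω (classicalPartial i φ) := by
  simp only [← (h.partial _).integral_norm_sq_fourier]
  rw [← integral_finsetSum _ fun i _ => integrable_norm_sq_schwartz _, ← integral_const_mul]
  refine integral_congr_ae (ae_of_all _ fun ξ => ?_)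
  simp only [h.norm_fourier_partial, EuclideanSpace.norm_sq_eq, Real.norm_eq_abs, sq_abs,
    Finset.sum_mul, Finset.mul_sum]

/-- The plane wave of frequency `ξ`. -/
def planeWave (ξ x : E3) : ℂ := Real.fourierChar (inner ℝ x ξ)

theorem norm_planeWave (ξ x : E3) : ‖planeWave ξ x‖ = 1 := Circle.norm_coe _

theorem continuous_planeWave : Continuous fun p : E3 × E3 => planeWave p.1 p.2 := by
  unfold planeWave
  have h : Continuous fun p : E3 × E3 => inner ℝ p.2 p.1 := by fun_prop
  exact continuous_subtype_val.comp (Real.continuous_fourierChar.comp h)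

theorem memL2_planeWave (hb : Bornology.IsBounded Ω) (ξ : E3) : MemL2 Ω (planeWave ξ) := by
  have : IsFiniteMeasure (volume.restrict Ω) := ⟨by
    rw [Measure.restrict_apply_univ]; exact hb.measure_lt_top⟩
  refine MemLp.of_bound ?_ 1 (ae_of_all _ fun x => (norm_planeWave ξ x).le)
  exact (continuous_planeWave.comp (Continuous.prodMk_right ξ)).aestronglyMeasurable

theorem IsTestFunction.fourier_eq_inner (hb : Bornology.IsBounded Ω) (h : IsTestFunction Ω φ)
    (ξ : E3) : 𝓕 h.toSchwartz ξ = inner ℂ (l2Class Ω (planeWave ξ)) (l2Class Ω φ) := by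
  rw [inner_l2Class (memL2_planeWave hb ξ) h.memL2, SchwartzMap.fourier_coe, Real.fourier_eq]
  rw [← setIntegral_eq_integral_of_forall_compl_eq_zero (s := Ω) (fun x hx => by
    rw [h.toSchwartz_apply, h.eq_zero_of_notMem hx, smul_zero])]
  refine integral_congr_ae (ae_of_all _ fun x => ?_)
  simp only [h.toSchwartz_apply, planeWave, AddChar.map_neg_eq_inv, Circle.smul_def,
    Circle.coe_inv_eq_conj, smul_eq_mul]
  ring

/-- Dominated convergence with the bound |e - e'|² ≤ 4 on a set of finite measure. Hence the plane
waves with frequency in a ball form a compact subset of L²(Ω). -/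
theorem continuous_l2Class_planeWave (hb : Bornology.IsBounded Ω) :
    Continuous fun ξ => l2Class Ω (planeWave ξ) := by
  have : IsFiniteMeasure (volume.restrict Ω) := ⟨by
    rw [Measure.restrict_apply_univ]; exact hb.measure_lt_top⟩
  rw [continuous_iff_continuousAt]
  intro η
  have hc : Continuous fun ξ => ∫ x in Ω, ‖planeWave ξ x - planeWave η x‖ ^ 2 := by
    refine continuous_of_dominated (bound := fun _ => 4) (fun ξ => ?_) (fun ξ => ?_)
      (integrable_const _) (ae_of_all _ fun x => ?_)
    · exact (((continuous_planeWave.comp (Continuous.prodMk_right ξ)).sub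
        (continuous_planeWave.comp (Continuous.prodMk_right η))).norm.pow 2).aestronglyMeasurable
    · refine ae_of_all _ fun x => ?_
      have := norm_sub_le (planeWave ξ x) (planeWave η x)
      rw [norm_planeWave, norm_planeWave] at this
      rw [Real.norm_eq_abs, abs_of_nonneg (sq_nonneg _)]
      nlinarith [norm_nonneg (planeWave ξ x - planeWave η x)]
    · exact (((continuous_planeWave.comp (Continuous.prodMk_left x)).sub
        continuous_const).norm.pow 2)
  have ht : Tendsto (fun ξ => ‖l2Class Ω (planeWave ξ) - l2Class Ω (planeWave η)‖ ^ 2) (𝓝 η)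
      (𝓝 0) := by
    have h0 := hc.tendsto η
    simp only [sub_self, norm_zero, ne_eq, OfNat.ofNat_ne_zero, not_false_eq_true, zero_pow,
      integral_zero] at h0
    refine h0.congr fun ξ => ?_
    rw [← l2Class_sub (memL2_planeWave hb ξ) (memL2_planeWave hb η),
      norm_sq_l2Class ((memL2_planeWave hb ξ).sub (memL2_planeWave hb η))]
    rfl
  rw [ContinuousAt, tendsto_iff_norm_sub_tendsto_zero]
  have := ht.sqrt
  simpa [Real.sqrt_sq] using this

/-- Quantitative Rellich compactness for test functions: up to a small multiple of the `H¹` norm,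
the `L²` norm is controlled by finitely many functionals. -/
theorem exists_functionals_test (hb : Bornology.IsBounded Ω) {ε : ℝ} (hε : 0 < ε) :
    ∃ (s : Finset (L2Space Ω →L[ℂ] ℂ)) (C : ℝ), ∀ φ, IsTestFunction Ω φ →
      l2NormSq Ω φ ≤ ε * (l2NormSq Ω φ + ∑ i, l2NormSq Ω (classicalPartial i φ))
        + C * ∑ l ∈ s, ‖l (l2Class Ω φ)‖ ^ 2 := by
  classical
  -- With R = ε^(-1/2), frequencies beyond R satisfy 1 ≤ ε|ξ|² and are paid for by the gradient
  -- term.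
  obtain ⟨R, hR0, hR⟩ : ∃ R : ℝ, 0 < R ∧ ε * R ^ 2 = 1 :=
    ⟨Real.sqrt ε⁻¹, Real.sqrt_pos.2 (inv_pos.2 hε), by
      rw [Real.sq_sqrt (inv_pos.2 hε).le, mul_inv_cancel₀ hε.ne']⟩
  set B : Set E3 := Metric.closedBall 0 R with hB
  set V : ℝ := volume.real B with hV
  have hV0 : 0 ≤ V := measureReal_nonneg
  -- On the ball, replacing a plane wave by a net point at distance δ costs at most 2δ²‖φ‖² at each
  -- frequency; integrated over volume V this must stay below ε‖φ‖².
  obtain ⟨δ, hδ0, hδ⟩ : ∃ δ : ℝ, 0 < δ ∧ 2 * V * δ ^ 2 ≤ ε := by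
    refine ⟨Real.sqrt (ε / (2 * V + 1)), Real.sqrt_pos.2 (by positivity), ?_⟩
    rw [Real.sq_sqrt (by positivity)]
    rw [mul_div_assoc', div_le_iff₀ (by positivity)]
    nlinarith
  -- Pairing with the points of a finite δ-net of the plane waves provides the required functionals.
  obtain ⟨t, -, htf, ht⟩ := ((isCompact_closedBall (0 : E3) R).image
    (continuous_l2Class_planeWave hb)).finite_cover_balls hδ0
  refine ⟨htf.toFinset.image (innerSL ℂ), 2 * V, fun φ hφ => ?_⟩
  set S := htf.toFinset.image (innerSL ℂ) with hS
  set M : ℝ := 2 * ∑ l ∈ S, ‖l (l2Class Ω φ)‖ ^ 2 + 2 * δ ^ 2 * l2NormSq Ω φ with hM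
  have hN0 : 0 ≤ l2NormSq Ω φ := l2NormSq_nonneg φ
  have hM0 : 0 ≤ M := by positivity
  have hlow : ∀ ξ ∈ B, ‖𝓕 hφ.toSchwartz ξ‖ ^ 2 ≤ M := by
    intro ξ hξ
    obtain ⟨g, hg, hgξ⟩ := Set.mem_iUnion₂.1 (ht (Set.mem_image_of_mem _ hξ))
    rw [Metric.mem_ball, dist_eq_norm] at hgξ
    have hgS : innerSL ℂ g ∈ S := Finset.mem_image_of_mem _ (htf.mem_toFinset.2 hg)
    have h1 : ‖inner ℂ g (l2Class Ω φ)‖ ^ 2 ≤ ∑ l ∈ S, ‖l (l2Class Ω φ)‖ ^ 2 :=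
      Finset.single_le_sum (f := fun l : L2Space Ω →L[ℂ] ℂ => ‖l (l2Class Ω φ)‖ ^ 2)
        (fun _ _ => sq_nonneg _) hgS
    have h2 : ‖𝓕 hφ.toSchwartz ξ‖ ≤ ‖inner ℂ g (l2Class Ω φ)‖ + δ * ‖l2Class Ω φ‖ := by
      rw [hφ.fourier_eq_inner hb, ← sub_add_cancel (l2Class Ω (planeWave ξ)) g, inner_add_left,
        add_comm]
      refine (norm_add_le _ _).trans (add_le_add le_rfl ?_)
      exact (norm_inner_le_norm _ _).trans (by gcongr)
    have h3 := norm_sq_l2Class hφ.memL2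
    calc ‖𝓕 hφ.toSchwartz ξ‖ ^ 2 ≤ (‖inner ℂ g (l2Class Ω φ)‖ + δ * ‖l2Class Ω φ‖) ^ 2 := by
          gcongr
      _ ≤ 2 * ‖inner ℂ g (l2Class Ω φ)‖ ^ 2 + 2 * (δ * ‖l2Class Ω φ‖) ^ 2 := by
          nlinarith [sq_nonneg (‖inner ℂ g (l2Class Ω φ)‖ - δ * ‖l2Class Ω φ‖)]
      _ ≤ M := by rw [mul_pow, h3, hM]; linarith
  have hBm : MeasurableSet B := Metric.isClosed_closedBall.measurableSet
  have hBfin : volume B ≠ ⊤ := (isCompact_closedBall (0 : E3) R).measure_ne_top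
  have hpt : ∀ ξ : E3, ‖𝓕 hφ.toSchwartz ξ‖ ^ 2
      ≤ ε * (‖ξ‖ ^ 2 * ‖𝓕 hφ.toSchwartz ξ‖ ^ 2) + B.indicator (fun _ => M) ξ := by
    intro ξ
    by_cases hξ : ξ ∈ B
    · rw [Set.indicator_of_mem hξ]
      have := hlow ξ hξ
      have : 0 ≤ ε * (‖ξ‖ ^ 2 * ‖𝓕 hφ.toSchwartz ξ‖ ^ 2) := by positivity
      linarith
    · rw [Set.indicator_of_notMem hξ, add_zero, ← mul_assoc]
      have hξR : R < ‖ξ‖ := by simpa [hB] using hξ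
      have : 1 ≤ ε * ‖ξ‖ ^ 2 := by rw [← hR]; gcongr
      exact le_mul_of_one_le_left (sq_nonneg _) this
  have hint := hφ.integrable_norm_sq_mul
  have hind : Integrable (B.indicator fun _ => M) :=
    (integrable_indicator_iff hBm).2 (integrableOn_const hBfin)
  have hmono := integral_mono (integrable_norm_sq_schwartz _) ((hint.const_mul ε).add hind) hpt
  rw [hφ.integral_norm_sq_fourier] at hmono
  simp only [Pi.add_apply] at hmono
  rw [integral_add (hint.const_mul ε) hind, integral_const_mul, integral_indicator_const _ hBm,
    smul_eq_mul] at hmono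
  have hI : ∫ ξ : E3, ‖ξ‖ ^ 2 * ‖𝓕 hφ.toSchwartz ξ‖ ^ 2
      ≤ ∑ i, l2NormSq Ω (classicalPartial i φ) := by
    rw [← hφ.integral_norm_sq_mul]
    -- The factor (2π)² of the Fourier normalization is at least 1 and is discarded.
    refine le_mul_of_one_le_left (integral_nonneg fun _ => by positivity) ?_
    nlinarith [Real.pi_gt_three]
  have h1 : ε * ∫ ξ : E3, ‖ξ‖ ^ 2 * ‖𝓕 hφ.toSchwartz ξ‖ ^ 2
      ≤ ε * ∑ i, l2NormSq Ω (classicalPartial i φ) := by gcongr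
  have h2 : 2 * V * δ ^ 2 * l2NormSq Ω φ ≤ ε * l2NormSq Ω φ := by gcongr
  have h3 : V * M = 2 * V * ∑ l ∈ S, ‖l (l2Class Ω φ)‖ ^ 2 + 2 * V * δ ^ 2 * l2NormSq Ω φ := by
    rw [hM]; ring
  linarith

end Compactness

/-! ### Dirichlet eigenvalues and Poincaré's inequality. -/

section Poincare

/-- Gradients of scalar fields, with the Hilbert norm. -/
abbrev GradSpace (Ω : Set E3) : Type := PiLp 2 fun _ : Fin 3 => L2Space Ω

/-- A function together with its weak gradient, as classes in `L²(Ω)`. -/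
def h1Jet (Ω : Set E3) (u : E3 → ℂ) : L2Space Ω × GradSpace Ω :=
  (l2Class Ω u, WithLp.toLp 2 fun i => l2Class Ω (weakPartial Ω i u))

theorem l2Class_zero (Ω : Set E3) : l2Class Ω 0 = 0 := by
  have h := l2Class_smul (Ω := Ω) 0 isTestFunction_zero.memL2
  rwa [zero_smul, zero_smul] at h

theorem classicalPartial_zero (i : Fin 3) : classicalPartial i 0 = 0 := by
  ext x
  simp [classicalPartial]

/-- The space of test functions together with their gradients. -/
def testJets (Ω : Set E3) : Submodule ℂ (L2Space Ω × GradSpace Ω) where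
  carrier := {f | ∃ φ, IsTestFunction Ω φ ∧
    f = (l2Class Ω φ, WithLp.toLp 2 fun i => l2Class Ω (classicalPartial i φ))}
  add_mem' := by
    rintro _ _ ⟨φ, hφ, rfl⟩ ⟨ψ, hψ, rfl⟩
    refine ⟨φ + ψ, hφ.add hψ, ?_⟩
    simp only [classicalPartial_add hφ hψ, l2Class_add hφ.memL2 hψ.memL2,
      l2Class_add (hφ.partial _).memL2 (hψ.partial _).memL2]
    rfl
  zero_mem' := by
    refine ⟨0, isTestFunction_zero, ?_⟩
    simp only [classicalPartial_zero, l2Class_zero]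
    rfl
  smul_mem' := by
    rintro c _ ⟨φ, hφ, rfl⟩
    refine ⟨c • φ, hφ.const_smul c, ?_⟩
    simp only [classicalPartial_smul c hφ, l2Class_smul c hφ.memL2,
      l2Class_smul c (hφ.partial _).memL2]
    rfl

variable {Ω : Set E3} {u v : E3 → ℂ}

theorem norm_sq_gradSpace (f : GradSpace Ω) : ‖f‖ ^ 2 = ∑ i, ‖f i‖ ^ 2 :=
  PiLp.norm_sq_eq_of_L2 _ f

theorem MemH10.h1Jet_mem (hb : Bornology.IsBounded Ω) (ho : IsOpen Ω) (hu : MemH10 Ω u) :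
    h1Jet Ω u ∈ (testJets Ω).topologicalClosure := by
  obtain ⟨φ, hφ, h0, h1⟩ := hu.exists_seq hb ho
  refine mem_closure_of_tendsto (f := fun n =>
    ((l2Class Ω (φ n), WithLp.toLp 2 fun i => l2Class Ω (classicalPartial i (φ n))) :
      L2Space Ω × GradSpace Ω)) (b := atTop) ?_ (Eventually.of_forall fun n => ⟨φ n, hφ n, rfl⟩)
  exact h0.prodMk_nhds (((PiLp.continuous_toLp 2 _).tendsto _).comp (tendsto_pi_nhds.2 h1))

/-- Both sides are continuous in the jet, so the estimate for test functions survives the closure.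
-/
theorem exists_functionals (hb : Bornology.IsBounded Ω) {ε : ℝ} (hε : 0 < ε) :
    ∃ (s : Finset (L2Space Ω →L[ℂ] ℂ)) (C : ℝ), ∀ f ∈ (testJets Ω).topologicalClosure,
      ‖f.1‖ ^ 2 ≤ ε * (‖f.1‖ ^ 2 + ‖f.2‖ ^ 2) + C * ∑ l ∈ s, ‖l f.1‖ ^ 2 := by
  obtain ⟨s, C, h⟩ := exists_functionals_test hb hε
  refine ⟨s, C, fun f hf => ?_⟩
  have hc : IsClosed {f : L2Space Ω × GradSpace Ω |
      ‖f.1‖ ^ 2 ≤ ε * (‖f.1‖ ^ 2 + ‖f.2‖ ^ 2) + C * ∑ l ∈ s, ‖l f.1‖ ^ 2} :=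
    isClosed_le (by fun_prop) (by fun_prop)
  refine closure_minimal ?_ hc hf
  rintro _ ⟨φ, hφ, rfl⟩
  simp only [Set.mem_ofPred_eq, norm_sq_gradSpace, norm_sq_l2Class hφ.memL2,
    norm_sq_l2Class (hφ.partial _).memL2]
  exact h φ hφ

/-- Every element of the closure of the test jets comes from a function of `H¹₀(Ω)`. -/
theorem exists_memH10_of_mem_closure (hb : Bornology.IsBounded Ω) (ho : IsOpen Ω)
    {f : L2Space Ω × GradSpace Ω} (hf : f ∈ (testJets Ω).topologicalClosure) :
    MemH10 Ω f.1 ∧ h1Jet Ω f.1 = f := by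
  have hweak : ∀ i, HasWeakPartial Ω i f.1 (f.2 i) := by
    intro i
    rw [hasWeakPartial_iff hb (memL2_coe _) (memL2_coe _), l2Class_coe, l2Class_coe]
    intro φ hφ
    have hc : IsClosed {f : L2Space Ω × GradSpace Ω |
        inner ℂ (l2Class Ω (classicalPartial i φ)) f.1 = -inner ℂ (l2Class Ω φ) (f.2 i)} :=
      isClosed_eq (by fun_prop) (by fun_prop)
    refine closure_minimal ?_ hc hf
    rintro _ ⟨ψ, hψ, rfl⟩
    exact inner_classicalPartial hφ hψ i
  have hH1 : MemH1 Ω f.1 := ⟨memL2_coe _, fun i => ⟨_, memL2_coe _, hweak i⟩⟩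
  have hl : ∀ i, l2Class Ω (weakPartial Ω i f.1) = f.2 i := fun i => by
    rw [l2Class_congr ((hweak i).weakPartial_ae_eq ho), l2Class_coe]
  refine ⟨⟨hH1, fun ε hε => ?_⟩, ?_⟩
  · have hc : Continuous fun g : L2Space Ω × GradSpace Ω => ‖g.1 - f.1‖ ^ 2 + ‖g.2 - f.2‖ ^ 2 := by
      fun_prop
    have hev : ∀ᶠ g in 𝓝 f, ‖g.1 - f.1‖ ^ 2 + ‖g.2 - f.2‖ ^ 2 < ε :=
      hc.continuousAt.eventually_lt continuousAt_const (by simpa using hε)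
    obtain ⟨_, hg, φ, hφ, rfl⟩ := mem_closure_iff_nhds.1 hf _ hev
    refine ⟨φ, hφ, ?_⟩
    rw [h1NormSq_sub_test hb ho hH1 hφ]
    simp only [hl, l2Class_coe]
    rw [Set.mem_ofPred_eq, norm_sq_gradSpace] at hg
    exact hg
  · simp only [h1Jet, hl, l2Class_coe]

theorem inner_gradSpace_h1Jet (ho : IsOpen Ω) (hu : MemH1 Ω u) (hv : MemH1 Ω v) :
    inner ℂ (h1Jet Ω v).2 (h1Jet Ω u).2
      = ∫ x in Ω, ∑ i, weakPartial Ω i u x * conj (weakPartial Ω i v x) := by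
  rw [integral_finsetSum _ fun i _ =>
    integrable_mul_conj (hv.memL2_weakPartial ho i) (hu.memL2_weakPartial ho i), PiLp.inner_apply]
  exact Finset.sum_congr rfl fun i _ =>
    inner_l2Class (hv.memL2_weakPartial ho i) (hu.memL2_weakPartial ho i)

/-- Testing the eigenvalue equation with w itself gives ‖∇w‖² = Λ‖w‖². This bounds the set of
eigenvalues below, as comparison with its `sInf` requires. -/
theorem IsDirichletEigenvalue.nonneg (ho : IsOpen Ω) {Λ : ℝ} (h : IsDirichletEigenvalue Ω Λ) :
    0 ≤ Λ := by
  obtain ⟨w, hw, hw0, heq⟩ := h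
  have h := heq w hw
  rw [← inner_gradSpace_h1Jet ho hw.1 hw.1, ← inner_l2Class hw.1.1 hw.1.1,
    inner_self_eq_ofReal, inner_self_eq_ofReal] at h
  have h' : ‖(h1Jet Ω w).2‖ ^ 2 = Λ * ‖l2Class Ω w‖ ^ 2 := by exact_mod_cast h
  have hne : l2Class Ω w ≠ 0 := by
    intro h0
    have hz : MemL2 Ω (0 : E3 → ℂ) := isTestFunction_zero.memL2
    refine hw0 (hw.1.1.ae_eq_of_l2Class_eq hz ?_)
    rw [h0, l2Class_zero]
  have hpos : 0 < ‖l2Class Ω w‖ ^ 2 := by positivity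
  by_contra hneg
  nlinarith [sq_nonneg ‖(h1Jet Ω w).2‖]

/-- Poincaré's inequality with the first Dirichlet eigenvalue. -/
theorem firstDirichletEigenvalue_mul_le (hb : Bornology.IsBounded Ω) (ho : IsOpen Ω)
    (hu : MemH10 Ω u) :
    firstDirichletEigenvalue Ω * ‖l2Class Ω u‖ ^ 2
      ≤ ∑ i, ‖l2Class Ω (weakPartial Ω i u)‖ ^ 2 := by
  by_cases hne : ∃ f ∈ (testJets Ω).topologicalClosure, f.1 ≠ 0
  · obtain ⟨P, w, hw, hw0, hmin, hEL⟩ := exists_rayleigh_minimizer (testJets Ω).topologicalClosure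
      (Submodule.isClosed_topologicalClosure _) (fun ε hε => exists_functionals hb hε) hne
    obtain ⟨hwH, hwJ⟩ := exists_memH10_of_mem_closure hb ho hw
    have hP : IsDirichletEigenvalue Ω P := by
      refine ⟨w.1, hwH, fun h0 => hw0 (Lp.ext (h0.trans (Lp.coeFn_zero _ _ _).symm)),
        fun v hv => ?_⟩
      rw [← inner_gradSpace_h1Jet ho hwH.1 hv.1, hwJ, ← inner_l2Class hv.1.1 hwH.1.1, l2Class_coe]
      exact hEL _ (hv.h1Jet_mem hb ho)
    -- It is enough that P belongs to the set of eigenvalues; that the infimum is attained plays no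
    -- role.
    have hle : firstDirichletEigenvalue Ω ≤ P :=
      csInf_le ⟨0, fun Λ hΛ => IsDirichletEigenvalue.nonneg ho hΛ⟩ hP
    have := hmin _ (hu.h1Jet_mem hb ho)
    rw [norm_sq_gradSpace] at this
    exact (mul_le_mul_of_nonneg_right hle (sq_nonneg _)).trans this
  · push Not at hne
    have : l2Class Ω u = 0 := hne _ (hu.h1Jet_mem hb ho)
    rw [this]
    simp only [norm_zero, ne_eq, OfNat.ofNat_ne_zero, not_false_eq_true, zero_pow, mul_zero]
    positivity

end Poincare

/-! ### Integration by parts in H²₀. -/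

section SecondOrder

variable {Ω : Set E3} {u v : E3 → ℂ}

theorem inner_classicalPartial_swap {φ ψ : E3 → ℂ} (hφ : IsTestFunction Ω φ)
    (hψ : IsTestFunction Ω ψ) (i j : Fin 3) :
    inner ℂ (l2Class Ω (classicalPartial i φ)) (l2Class Ω (classicalPartial j ψ))
      = inner ℂ (l2Class Ω (classicalPartial j φ)) (l2Class Ω (classicalPartial i ψ)) := by
  rw [inner_classicalPartial hφ (hψ.partial j), inner_classicalPartial hφ (hψ.partial i),
    classicalPartial_comm hψ]

/-- Two integrations by parts and the symmetry of second derivatives for test functions, followed by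
a limit. -/
theorem MemH20.inner_weakPartial_swap (hb : Bornology.IsBounded Ω) (ho : IsOpen Ω)
    (hu : MemH20 Ω u) (hv : MemH20 Ω v) (i j : Fin 3) :
    inner ℂ (l2Class Ω (weakPartial Ω i u)) (l2Class Ω (weakPartial Ω j v))
      = inner ℂ (l2Class Ω (weakPartial Ω j u)) (l2Class Ω (weakPartial Ω i v)) := by
  obtain ⟨φ, hφ, -, h1, -⟩ := hu.exists_seq hb ho
  obtain ⟨ψ, hψ, -, k1, -⟩ := hv.exists_seq hb ho
  refine tendsto_nhds_unique ((h1 i).inner (k1 j)) (((h1 j).inner (k1 i)).congr fun n => ?_)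
  exact inner_classicalPartial_swap (hφ n) (hψ n) j i

theorem MemH20.inner_weakPartial_weakPartial (hb : Bornology.IsBounded Ω) (ho : IsOpen Ω)
    (hu : MemH20 Ω u) (hv : MemH20 Ω v) (i j : Fin 3) :
    inner ℂ (l2Class Ω u) (l2Class Ω (weakPartial Ω i (weakPartial Ω j v)))
      = -inner ℂ (l2Class Ω (weakPartial Ω i u)) (l2Class Ω (weakPartial Ω j v)) := by
  obtain ⟨φ, hφ, h0, h1, -⟩ := hu.exists_seq hb ho
  obtain ⟨ψ, hψ, -, k1, k2⟩ := hv.exists_seq hb ho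
  refine tendsto_nhds_unique (h0.inner (k2 i j)) (((h1 i).inner (k1 j)).neg.congr fun n => ?_)
  rw [inner_classicalPartial (hφ n) ((hψ n).partial j), neg_neg]

theorem MemH20.inner_second_swap (hb : Bornology.IsBounded Ω) (ho : IsOpen Ω)
    (hu : MemH20 Ω u) (hv : MemH20 Ω v) (i j k l : Fin 3) :
    inner ℂ (l2Class Ω (weakPartial Ω i (weakPartial Ω j u)))
        (l2Class Ω (weakPartial Ω k (weakPartial Ω l v)))
      = inner ℂ (l2Class Ω (weakPartial Ω k (weakPartial Ω j u)))
        (l2Class Ω (weakPartial Ω i (weakPartial Ω l v))) := by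
  obtain ⟨φ, hφ, -, -, h2⟩ := hu.exists_seq hb ho
  obtain ⟨ψ, hψ, -, -, k2⟩ := hv.exists_seq hb ho
  refine tendsto_nhds_unique ((h2 i j).inner (k2 k l))
    (((h2 k j).inner (k2 i l)).congr fun n => ?_)
  exact inner_classicalPartial_swap ((hφ n).partial j) ((hψ n).partial l) k i

theorem MemH20.l2Class_second_comm (hb : Bornology.IsBounded Ω) (ho : IsOpen Ω)
    (hu : MemH20 Ω u) (i j : Fin 3) :
    l2Class Ω (weakPartial Ω i (weakPartial Ω j u))
      = l2Class Ω (weakPartial Ω j (weakPartial Ω i u)) := by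
  obtain ⟨φ, hφ, -, -, h2⟩ := hu.exists_seq hb ho
  refine tendsto_nhds_unique (h2 i j) ((h2 j i).congr fun n => ?_)
  rw [classicalPartial_comm (hφ n)]

theorem MemH20.memL2_second (ho : IsOpen Ω) (hu : MemH20 Ω u) (i j : Fin 3) :
    MemL2 Ω (weakPartial Ω i (weakPartial Ω j u)) :=
  (hu.1.2 j).memL2_weakPartial ho i

end SecondOrder

/-! ### Norm identities and estimates for the Lamé operator. -/

section Lame

variable {Ω : Set E3}

theorem memL2_sum {u : Fin 3 → E3 → ℂ} (h : ∀ i, MemL2 Ω (u i)) : MemL2 Ω (∑ i, u i) := by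
  simp only [Fin.sum_univ_three]
  exact ((h 0).add (h 1)).add (h 2)

theorem l2Class_sum {u : Fin 3 → E3 → ℂ} (h : ∀ i, MemL2 Ω (u i)) :
    l2Class Ω (∑ i, u i) = ∑ i, l2Class Ω (u i) := by
  simp only [Fin.sum_univ_three]
  rw [l2Class_add ((h 0).add (h 1)) (h 2), l2Class_add (h 0) (h 1)]

/-- `lame` differentiates the divergence as one function, while the estimates work with separate
second derivatives; linearity of weak derivatives links the two. -/
theorem hasWeakPartial_divergence (hb : Bornology.IsBounded Ω) (ho : IsOpen Ω) {u : VField}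
    (hu : ∀ i, MemH2 Ω (u i)) (i : Fin 3) :
    HasWeakPartial Ω i (divergence Ω u)
      (∑ j, weakPartial Ω i (weakPartial Ω j (u j))) := by
  have e : divergence Ω u = ∑ j, weakPartial Ω j (u j) := by
    ext x
    simp [divergence]
  have m1 : ∀ j, MemL2 Ω (weakPartial Ω j (u j)) := fun j => (hu j).1.memL2_weakPartial ho j
  have m2 : ∀ j, MemL2 Ω (weakPartial Ω i (weakPartial Ω j (u j))) := fun j =>
    ((hu j).2 j).memL2_weakPartial ho i
  rw [e, hasWeakPartial_iff hb (memL2_sum m1) (memL2_sum m2)]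
  intro φ hφ
  rw [l2Class_sum m1, l2Class_sum m2, inner_sum, inner_sum, ← Finset.sum_neg_distrib]
  exact Finset.sum_congr rfl fun j _ =>
    (hasWeakPartial_iff hb (m1 j) (m2 j)).1 (((hu j).2 j).hasWeakPartial i) φ hφ

theorem lame_ae_eq (lam mu : ℝ) (hb : Bornology.IsBounded Ω) (ho : IsOpen Ω) {u : VField}
    (hu : ∀ i, MemH2 Ω (u i)) (i : Fin 3) :
    lame lam mu Ω u i =ᵐ[volume.restrict Ω]
      (mu : ℂ) • ∑ j, weakPartial Ω j (weakPartial Ω j (u i))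
        + ((lam + mu : ℝ) : ℂ) • ∑ j, weakPartial Ω i (weakPartial Ω j (u j)) := by
  filter_upwards [(hasWeakPartial_divergence hb ho hu i).weakPartial_ae_eq ho] with x hx
  simp only [lame, hx, Pi.add_apply, Pi.smul_apply, Finset.sum_apply, smul_eq_mul]

theorem memL2_lame (lam mu : ℝ) (hb : Bornology.IsBounded Ω) (ho : IsOpen Ω) {u : VField}
    (hu : ∀ i, MemH2 Ω (u i)) (i : Fin 3) : MemL2 Ω (lame lam mu Ω u i) := by
  refine MemLp.ae_eq (lame_ae_eq lam mu hb ho hu i).symm ?_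
  exact ((memL2_sum fun j => ((hu i).2 j).memL2_weakPartial ho j).const_smul _).add
    ((memL2_sum fun j => ((hu j).2 j).memL2_weakPartial ho i).const_smul _)

theorem l2Class_lame (lam mu : ℝ) (hb : Bornology.IsBounded Ω) (ho : IsOpen Ω) {u : VField}
    (hu : ∀ i, MemH2 Ω (u i)) (i : Fin 3) :
    l2Class Ω (lame lam mu Ω u i)
      = (mu : ℂ) • ∑ j, l2Class Ω (weakPartial Ω j (weakPartial Ω j (u i)))
        + ((lam + mu : ℝ) : ℂ) • ∑ j, l2Class Ω (weakPartial Ω i (weakPartial Ω j (u j))) := by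
  have m1 : ∀ j, MemL2 Ω (weakPartial Ω j (weakPartial Ω j (u i))) := fun j =>
    ((hu i).2 j).memL2_weakPartial ho j
  have m2 : ∀ j, MemL2 Ω (weakPartial Ω i (weakPartial Ω j (u j))) := fun j =>
    ((hu j).2 j).memL2_weakPartial ho i
  rw [l2Class_congr (lame_ae_eq lam mu hb ho hu i),
    l2Class_add ((memL2_sum m1).const_smul _) ((memL2_sum m2).const_smul _),
    l2Class_smul _ (memL2_sum m1), l2Class_smul _ (memL2_sum m2), l2Class_sum m1, l2Class_sum m2]

/-- `‖u‖²` in `L²(Ω)³`. -/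
def normSq0 (Ω : Set E3) (u : VField) : ℝ := ∑ a, ‖l2Class Ω (u a)‖ ^ 2

/-- `‖∇u‖²` in `L²(Ω)`. -/
def normSq1 (Ω : Set E3) (u : VField) : ℝ := ∑ a, ∑ i, ‖l2Class Ω (weakPartial Ω i (u a))‖ ^ 2

/-- The square of the `L²(Ω)` norm of all second derivatives of `u`. -/
def normSq2 (Ω : Set E3) (u : VField) : ℝ :=
  ∑ a, ∑ i, ∑ j, ‖l2Class Ω (weakPartial Ω i (weakPartial Ω j (u a)))‖ ^ 2

/-- The elastic energy `∫ ∇u : C : ∇ū`. -/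
def elasticEnergy (lam mu : ℝ) (Ω : Set E3) (u : VField) : ℝ :=
  mu * normSq1 Ω u + (lam + mu) * ‖∑ i, l2Class Ω (weakPartial Ω i (u i))‖ ^ 2

/-- `‖Δ*u‖²` in `L²(Ω)³`. -/
def lameNormSq (lam mu : ℝ) (Ω : Set E3) (u : VField) : ℝ :=
  ∑ a, ‖l2Class Ω (lame lam mu Ω u a)‖ ^ 2

variable {lam mu : ℝ} {u : VField}

theorem MemH20Vec.memH2 (hu : MemH20Vec Ω u) (i : Fin 3) : MemH2 Ω (u i) := (hu i).1

theorem MemH20Vec.h2NormSqVec_eq (ho : IsOpen Ω) (hu : MemH20Vec Ω u) :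
    h2NormSqVec Ω u = normSq0 Ω u + normSq1 Ω u + normSq2 Ω u := by
  simp only [normSq0, normSq1, normSq2, ← Finset.sum_add_distrib]
  refine Finset.sum_congr rfl fun a _ => ?_
  simp only [h2NormSq, norm_sq_l2Class (hu a).1.1.1,
    norm_sq_l2Class ((hu a).1.1.memL2_weakPartial ho _), norm_sq_l2Class ((hu a).memL2_second ho _ _)]

theorem MemH20Vec.sum_inner_lame (hb : Bornology.IsBounded Ω) (ho : IsOpen Ω)
    (hu : MemH20Vec Ω u) :
    ∑ a, inner ℂ (l2Class Ω (u a)) (l2Class Ω (lame lam mu Ω u a))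
      = -((elasticEnergy lam mu Ω u : ℝ) : ℂ) := by
  simp only [l2Class_lame lam mu hb ho hu.memH2]
  exact ElasticITP.sum_inner_lame lam mu (f := fun a => l2Class Ω (u a))
    (g := fun a i => l2Class Ω (weakPartial Ω i (u a)))
    (H := fun a i j => l2Class Ω (weakPartial Ω i (weakPartial Ω j (u a))))
    fun a b i j => (hu b).inner_weakPartial_weakPartial hb ho (hu a) i j

theorem MemH20Vec.normSq2_le (hb : Bornology.IsBounded Ω) (ho : IsOpen Ω) (hmu : 0 < mu)
    (hlm : 0 < lam + mu) (hu : MemH20Vec Ω u) :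
    mu ^ 2 * normSq2 Ω u ≤ lameNormSq lam mu Ω u := by
  simp only [lameNormSq, l2Class_lame lam mu hb ho hu.memH2]
  exact sum_norm_sq_lame_ge hmu hlm
    (H := fun a i j => l2Class Ω (weakPartial Ω i (weakPartial Ω j (u a))))
    (fun a i j => (hu a).l2Class_second_comm hb ho i j)
    fun a b i j k l => (hu a).inner_second_swap hb ho (hu b) i j k l

theorem MemH20Vec.poincare (hb : Bornology.IsBounded Ω) (ho : IsOpen Ω) (hu : MemH20Vec Ω u) :
    firstDirichletEigenvalue Ω * normSq0 Ω u ≤ normSq1 Ω u := by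
  rw [normSq0, normSq1, Finset.mul_sum]
  exact Finset.sum_le_sum fun a _ => firstDirichletEigenvalue_mul_le hb ho (hu a).memH10

/-- The cross term is -2tD since ⟨u, Δ*u⟩ = -D. Used with t = ω² for the weighted integral, and with
t = K for the nonnegativity of X - 2KD + K²N. -/
theorem MemH20Vec.sum_norm_sq_lame_add (hb : Bornology.IsBounded Ω) (ho : IsOpen Ω)
    (hu : MemH20Vec Ω u) (t : ℝ) :
    ∑ a, ‖l2Class Ω (lame lam mu Ω u a) + (t : ℂ) • l2Class Ω (u a)‖ ^ 2
      = lameNormSq lam mu Ω u - 2 * t * elasticEnergy lam mu Ω u + t ^ 2 * normSq0 Ω u := by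
  have h := congrArg Complex.re (hu.sum_inner_lame (lam := lam) (mu := mu) hb ho)
  rw [Complex.re_sum, Complex.neg_re, Complex.ofReal_re] at h
  have e : ∀ a, ‖l2Class Ω (lame lam mu Ω u a) + (t : ℂ) • l2Class Ω (u a)‖ ^ 2
      = ‖l2Class Ω (lame lam mu Ω u a)‖ ^ 2
        + 2 * t * (inner ℂ (l2Class Ω (u a)) (l2Class Ω (lame lam mu Ω u a))).re
        + t ^ 2 * ‖l2Class Ω (u a)‖ ^ 2 := by
    intro a
    rw [@norm_add_sq ℂ, inner_re_symm]
    simp only [inner_smul_left, norm_smul, Complex.conj_ofReal, Complex.norm_real,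
      mul_pow, Real.norm_eq_abs, sq_abs, RCLike.re_to_complex, Complex.re_ofReal_mul]
    ring
  simp only [e, Finset.sum_add_distrib, ← Finset.mul_sum, h, lameNormSq, normSq0]
  ring

theorem normSq1_nonneg (Ω : Set E3) (u : VField) : 0 ≤ normSq1 Ω u :=
  Finset.sum_nonneg fun _ _ => Finset.sum_nonneg fun _ _ => sq_nonneg _

theorem mul_normSq1_le (hlm : 0 < lam + mu) (u : VField) :
    mu * normSq1 Ω u ≤ elasticEnergy lam mu Ω u := by
  rw [elasticEnergy]
  exact le_add_of_nonneg_right (by positivity)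

/-- If `K ‖u‖² ≤ ∫ ∇u : C : ∇ū`, the `H²` norm of `u` is controlled by `‖Δ*u‖`. -/
theorem MemH20Vec.h2NormSqVec_le (hb : Bornology.IsBounded Ω) (ho : IsOpen Ω) (hmu : 0 < mu)
    (hlm : 0 < lam + mu) (hu : MemH20Vec Ω u) {K : ℝ} (hK : 0 < K)
    (hKN : K * normSq0 Ω u ≤ elasticEnergy lam mu Ω u) :
    h2NormSqVec Ω u ≤ (1 / K ^ 2 + 1 / (K * mu) + 1 / mu ^ 2) * lameNormSq lam mu Ω u := by
  have hX : 0 ≤ lameNormSq lam mu Ω u - 2 * K * elasticEnergy lam mu Ω u + K ^ 2 * normSq0 Ω u := by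
    rw [← hu.sum_norm_sq_lame_add hb ho]; positivity
  have h2 := hu.normSq2_le hb ho hmu hlm
  have h1 := mul_normSq1_le (Ω := Ω) hlm u
  set X := lameNormSq lam mu Ω u
  set D := elasticEnergy lam mu Ω u
  -- From `hX` and KN ≤ D one gets X ≥ 2KD - K²N ≥ KD, and then N ≤ X/K² and ‖∇u‖² ≤ X/(Kμ).
  have hKK : K * (K * normSq0 Ω u) ≤ K * D := by gcongr
  have hKD : K * D ≤ X := by nlinarith
  have a0 : normSq0 Ω u ≤ 1 / K ^ 2 * X := by
    rw [one_div, inv_mul_eq_div, le_div_iff₀ (by positivity)]; nlinarith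
  have a1 : normSq1 Ω u ≤ 1 / (K * mu) * X := by
    rw [one_div, inv_mul_eq_div, le_div_iff₀ (by positivity)]
    have : K * (mu * normSq1 Ω u) ≤ K * D := by gcongr
    nlinarith
  have a2 : normSq2 Ω u ≤ 1 / mu ^ 2 * X := by
    rw [one_div, inv_mul_eq_div, le_div_iff₀ (by positivity)]; nlinarith
  rw [hu.h2NormSqVec_eq ho]
  linarith

end Lame

/-! ### The quadratic form in terms of X, D and N. -/

section Form

variable {Ω : Set E3} {lam mu : ℝ} {u : VField}

/-- The weighted part `∫ (1-ρ)⁻¹ |(Δ*+ω²)u|²` of the form. -/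
def weightedPart (lam mu : ℝ) (Ω : Set E3) (ρ : E3 → ℝ) (ω : ℝ) (u : VField) : ℝ :=
  ∫ x in Ω, (1 - ρ x)⁻¹ * ∑ i, ‖lame lam mu Ω u i x + (ω : ℂ) ^ 2 * u i x‖ ^ 2

/-- On the diagonal the weighted integrand is real pointwise, and integration by parts makes the
elastic term real; this is where the reality of a(u,u) comes from. -/
theorem MemH20Vec.formA_self (hb : Bornology.IsBounded Ω) (ho : IsOpen Ω) (hu : MemH20Vec Ω u)
    (ρ : E3 → ℝ) (ω : ℝ) :
    formA lam mu Ω ρ ω u u = ((weightedPart lam mu Ω ρ ω u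
      + ω ^ 2 * elasticEnergy lam mu Ω u - ω ^ 4 * normSq0 Ω u : ℝ) : ℂ) := by
  have e1 : (∫ x in Ω, (((1 - ρ x)⁻¹ : ℝ) : ℂ) *
      ∑ i, (lame lam mu Ω u i x + (ω : ℂ) ^ 2 * u i x)
        * conj (lame lam mu Ω u i x + (ω : ℂ) ^ 2 * u i x))
      = ((weightedPart lam mu Ω ρ ω u : ℝ) : ℂ) := by
    rw [weightedPart, ← integral_complex_ofReal]
    refine integral_congr_ae (ae_of_all _ fun x => ?_)
    simp only [Complex.mul_conj, Complex.normSq_eq_norm_sq]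
    push_cast
    rfl
  have m1 : ∀ a i, MemL2 Ω (weakPartial Ω i (u a)) := fun a i =>
    (hu a).1.1.memL2_weakPartial ho i
  have hint : ∀ i j k l, Integrable (fun x => weakPartial Ω j (u i) x *
      (moduli lam mu i j k l : ℂ) * conj (weakPartial Ω l (u k) x)) (volume.restrict Ω) := by
    intro i j k l
    refine ((integrable_mul_conj (m1 k l) (m1 i j)).const_mul (moduli lam mu i j k l : ℂ)).congr
      (ae_of_all _ fun x => ?_)
    simp only
    ring
  have e2 : (∫ x in Ω, ∑ i, ∑ j, ∑ k, ∑ l,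
        weakPartial Ω j (u i) x * (moduli lam mu i j k l : ℂ)
          * conj (weakPartial Ω l (u k) x)) = ((elasticEnergy lam mu Ω u : ℝ) : ℂ) := by
    rw [elasticEnergy, normSq1, ← sum_moduli_inner lam mu
      (g := fun a i => l2Class Ω (weakPartial Ω i (u a)))
      fun a b i j => (hu a).inner_weakPartial_swap hb ho (hu b) i j]
    rw [integral_finsetSum _ fun i _ => integrable_finsetSum _ fun j _ =>
      integrable_finsetSum _ fun k _ => integrable_finsetSum _ fun l _ => hint i j k l]
    refine Finset.sum_congr rfl fun i _ => ?_
    rw [integral_finsetSum _ fun j _ =>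
      integrable_finsetSum _ fun k _ => integrable_finsetSum _ fun l _ => hint i j k l]
    refine Finset.sum_congr rfl fun j _ => ?_
    rw [integral_finsetSum _ fun k _ => integrable_finsetSum _ fun l _ => hint i j k l]
    refine Finset.sum_congr rfl fun k _ => ?_
    rw [integral_finsetSum _ fun l _ => hint i j k l]
    refine Finset.sum_congr rfl fun l _ => ?_
    rw [inner_l2Class (m1 k l) (m1 i j), ← integral_const_mul]
    refine integral_congr_ae (ae_of_all _ fun x => ?_)
    simp only
    ring
  have e3 : ∫ x in Ω, ∑ i, u i x * conj (u i x) = ((normSq0 Ω u : ℝ) : ℂ) := by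
    rw [integral_finsetSum _ fun i _ => integrable_mul_conj (hu i).1.1.1 (hu i).1.1.1, normSq0]
    push_cast
    refine Finset.sum_congr rfl fun i _ => ?_
    rw [← inner_l2Class (hu i).1.1.1 (hu i).1.1.1, inner_self_eq_ofReal]
    push_cast
    rfl
  rw [formA, e1, e2, e3]
  push_cast
  ring

/-- A bounded weight can be replaced by a lower bound. -/
theorem MemH20Vec.le_integral_weight (hb : Bornology.IsBounded Ω) (ho : IsOpen Ω)
    (hu : MemH20Vec Ω u) {κ : E3 → ℝ} (hκ : AEStronglyMeasurable κ (volume.restrict Ω))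
    {c B : ℝ} (hc : ∀ᵐ x ∂(volume.restrict Ω), c ≤ κ x)
    (hB : ∀ᵐ x ∂(volume.restrict Ω), ‖κ x‖ ≤ B) (ω : ℝ) :
    c * (lameNormSq lam mu Ω u - 2 * ω ^ 2 * elasticEnergy lam mu Ω u + ω ^ 4 * normSq0 Ω u)
      ≤ ∫ x in Ω, κ x * ∑ i, ‖lame lam mu Ω u i x + (ω : ℂ) ^ 2 * u i x‖ ^ 2 := by
  have hm : ∀ i, MemL2 Ω (lame lam mu Ω u i + ((ω ^ 2 : ℝ) : ℂ) • u i) := fun i =>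
    (memL2_lame lam mu hb ho hu.memH2 i).add ((hu i).1.1.1.const_smul _)
  have hint : ∀ i, Integrable (fun x => ‖lame lam mu Ω u i x + (ω : ℂ) ^ 2 * u i x‖ ^ 2)
      (volume.restrict Ω) := by
    intro i
    have h : Integrable (fun x => ‖(lame lam mu Ω u i + ((ω ^ 2 : ℝ) : ℂ) • u i) x‖ ^ 2)
      (volume.restrict Ω) := (memLp_two_iff_integrable_sq_norm (hm i).1).1 (hm i)
    simpa using h
  have hsum : Integrable (fun x => ∑ i, ‖lame lam mu Ω u i x + (ω : ℂ) ^ 2 * u i x‖ ^ 2)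
      (volume.restrict Ω) := integrable_finsetSum _ fun i _ => hint i
  have e : lameNormSq lam mu Ω u - 2 * ω ^ 2 * elasticEnergy lam mu Ω u + ω ^ 4 * normSq0 Ω u
      = ∫ x in Ω, ∑ i, ‖lame lam mu Ω u i x + (ω : ℂ) ^ 2 * u i x‖ ^ 2 := by
    have h := hu.sum_norm_sq_lame_add (lam := lam) (mu := mu) hb ho (ω ^ 2)
    rw [show (ω ^ 2) ^ 2 = ω ^ 4 by ring] at h
    rw [← h, integral_finsetSum _ fun i _ => hint i]
    refine Finset.sum_congr rfl fun i _ => ?_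
    rw [← l2Class_smul _ (hu i).1.1.1, ← l2Class_add (memL2_lame lam mu hb ho hu.memH2 i)
      ((hu i).1.1.1.const_smul _), norm_sq_l2Class (hm i), l2NormSq]
    refine integral_congr_ae (ae_of_all _ fun x => ?_)
    simp
  rw [e, ← integral_const_mul]
  refine integral_mono_ae (hsum.const_mul c) (hsum.bdd_mul hκ hB) ?_
  filter_upwards [hc] with x hx
  exact mul_le_mul_of_nonneg_right hx (Finset.sum_nonneg fun _ _ => sq_nonneg _)

end Form

/-! ### Coercivity of the factored quadratic form. -/

section Coercivity

variable {Ω : Set E3} {lam mu : ℝ}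

/-- In ℝ, `essInf` and `essSup` are meaningful only for essentially bounded functions; membership in
L^∞ supplies the two-sided bound. -/
theorem ae_essInf_le_and_le_essSup {ρ : E3 → ℝ} (hρ : MemLp ρ ⊤ (volume.restrict Ω)) :
    ∀ᵐ x ∂(volume.restrict Ω),
      essInf ρ (volume.restrict Ω) ≤ ρ x ∧ ρ x ≤ essSup ρ (volume.restrict Ω) := by
  obtain ⟨M, hM⟩ : ∃ M : ℝ, ∀ᵐ x ∂(volume.restrict Ω), ‖ρ x‖ ≤ M := by
    refine ⟨(eLpNormEssSup ρ (volume.restrict Ω)).toReal, ?_⟩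
    have hfin : eLpNormEssSup ρ (volume.restrict Ω) ≠ ⊤ := by
      rw [← eLpNorm_exponent_top]; exact hρ.eLpNorm_ne_top
    filter_upwards [ae_le_eLpNormEssSup (f := ρ) (μ := volume.restrict Ω)] with x hx
    simpa using ENNReal.toReal_mono hfin hx
  have hup : IsBoundedUnder (· ≤ ·) (ae (volume.restrict Ω)) ρ :=
    ⟨M, by
      rw [eventually_map]
      filter_upwards [hM] with x hx using (le_abs_self _).trans hx⟩
  have hlo : IsBoundedUnder (· ≥ ·) (ae (volume.restrict Ω)) ρ :=
    ⟨-M, by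
      rw [eventually_map]
      filter_upwards [hM] with x hx using (abs_le.1 hx).1⟩
  filter_upwards [ae_le_essSup hup, ae_essInf_le hlo] with x h1 h2 using ⟨h2, h1⟩

/-- The divergence part of the energy is nonnegative, and μ‖∇u‖² ≥ m‖∇u‖² is bounded below by
Poincaré componentwise. -/
theorem MemH20Vec.mul_normSq0_le {u : VField} (hb : Bornology.IsBounded Ω) (ho : IsOpen Ω)
    (hlm : 0 < lam + mu) {m : ℝ} (hm : 0 < m) (hmmu : m ≤ mu) (hu : MemH20Vec Ω u) :
    m * firstDirichletEigenvalue Ω * normSq0 Ω u ≤ elasticEnergy lam mu Ω u := by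
  have h1 := mul_le_mul_of_nonneg_left (hu.poincare hb ho) hm.le
  have h2 := mul_le_mul_of_nonneg_right hmmu (normSq1_nonneg Ω u)
  have h3 := mul_normSq1_le (Ω := Ω) hlm u
  linarith

/-- Lower bound for the quadratic form `‖Δ*u‖² - (a+b) ∫ ∇u : C : ∇ū + ab ‖u‖²`. -/
theorem exists_lower_bound (hb : Bornology.IsBounded Ω) (ho : IsOpen Ω) (hmu : 0 < mu)
    (hlm : 0 < lam + mu) {m : ℝ} (hm : 0 < m) (hmmu : m ≤ mu) {a b : ℝ} (ha : 0 ≤ a) (hb0 : 0 ≤ b)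
    (haK : a < m * firstDirichletEigenvalue Ω) (hbK : b < m * firstDirichletEigenvalue Ω) :
    ∃ C : ℝ, 0 < C ∧ ∀ u : VField, MemH20Vec Ω u →
      C * h2NormSqVec Ω u ≤ lameNormSq lam mu Ω u - (a + b) * elasticEnergy lam mu Ω u
        + a * b * normSq0 Ω u := by
  set K := m * firstDirichletEigenvalue Ω
  -- Positivity of mλ₁ comes from the strict upper bound on a, not from a spectral argument.
  have hK : 0 < K := lt_of_le_of_lt ha haK
  set Q : ℝ := 1 / K ^ 2 + 1 / (K * mu) + 1 / mu ^ 2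
  have hQ : 0 < Q := by positivity
  set c : ℝ := (1 - a / K) * (1 - b / K)
  have hc : 0 < c :=
    mul_pos (sub_pos.2 ((div_lt_one hK).2 haK)) (sub_pos.2 ((div_lt_one hK).2 hbK))
  refine ⟨c / Q, by positivity, fun u hu => ?_⟩
  have hKN := hu.mul_normSq0_le (lam := lam) (mu := mu) hb ho hlm hm hmmu
  have hX : 0 ≤ lameNormSq lam mu Ω u - 2 * K * elasticEnergy lam mu Ω u + K ^ 2 * normSq0 Ω u := by
    rw [← hu.sum_norm_sq_lame_add hb ho]; positivity
  refine le_trans ?_ (quadratic_lower_bound hK ha haK.le hb0 hbK.le hKN hX)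
  have h := mul_le_mul_of_nonneg_left (hu.h2NormSqVec_le hb ho hmu hlm hK hKN)
    (show 0 ≤ c / Q by positivity)
  refine h.trans (le_of_eq ?_)
  rw [← mul_assoc, div_mul_cancel₀ _ hQ.ne']

end Coercivity

end ElasticITP

end

/-! ### The two contrast regimes ρ_* > 1 and ρ^* < 1. -/

theorem mainTheorem8
    (Ω : Set ElasticITP.E3) (hΩ_open : IsOpen Ω) (hΩ_ne : Ω.Nonempty)
    (hΩ_bdd : Bornology.IsBounded Ω)
    (lam mu : ℝ) (hmu : 0 < mu) (hlam : 0 < 3 * lam + 2 * mu)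
    (ρ : ElasticITP.E3 → ℝ) (hρ_mem : MemLp ρ ⊤ (volume.restrict Ω))
    (hρ_pos : ∀ᵐ x ∂(volume.restrict Ω), 0 < ρ x)
    (ω : ℝ) (hω_pos : 0 < ω ^ 2)
    (hω_lt : ω ^ 2 < min
      (min mu (3 * lam + 2 * mu) * ElasticITP.firstDirichletEigenvalue Ω
        / essSup ρ (volume.restrict Ω))
      (min mu (3 * lam + 2 * mu) * ElasticITP.firstDirichletEigenvalue Ω)) :
    (1 < essInf ρ (volume.restrict Ω) →
      ∃ C : ℝ, 0 < C ∧ ∀ u : ElasticITP.VField, ElasticITP.MemH20Vec Ω u →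
        (ElasticITP.formA lam mu Ω ρ ω u u).im = 0 ∧
        C * ElasticITP.h2NormSqVec Ω u ≤ -(ElasticITP.formA lam mu Ω ρ ω u u).re) ∧
    (essSup ρ (volume.restrict Ω) < 1 →
      ∃ C : ℝ, 0 < C ∧ ∀ u : ElasticITP.VField, ElasticITP.MemH20Vec Ω u →
        (ElasticITP.formA lam mu Ω ρ ω u u).im = 0 ∧
        C * ElasticITP.h2NormSqVec Ω u ≤ (ElasticITP.formA lam mu Ω ρ ω u u).re) := by
  open ElasticITP in
  -- Indeed 3(λ+μ) = (3λ+2μ) + μ.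
  have hlm : 0 < lam + mu := by linarith
  have hm : 0 < min mu (3 * lam + 2 * mu) := lt_min hmu hlam
  have hmmu : min mu (3 * lam + 2 * mu) ≤ mu := min_le_left _ _
  obtain ⟨hω1, hω2⟩ := lt_min_iff.1 hω_lt
  have hess := ae_essInf_le_and_le_essSup hρ_mem
  have hmeas : AEStronglyMeasurable (fun x => (1 - ρ x)⁻¹) (volume.restrict Ω) :=
    (aemeasurable_const.sub hρ_mem.1.aemeasurable).inv.aestronglyMeasurable
  constructor
  · intro hlow
    set ρs := essSup ρ (volume.restrict Ω)
    set ρi := essInf ρ (volume.restrict Ω)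
    -- A non-empty open set has positive measure, so some point witnesses ρ_* ≤ ρ^*.
    have hne : (ae (volume.restrict Ω)).NeBot := by
      rw [ae_neBot, Ne, Measure.restrict_eq_zero]
      exact (hΩ_open.measure_pos volume hΩ_ne).ne'
    obtain ⟨x₀, hx₀⟩ := hess.exists
    have hs1 : 1 < ρs := by linarith [hx₀.1, hx₀.2]
    have hb' : ρs * ω ^ 2 < min mu (3 * lam + 2 * mu) * firstDirichletEigenvalue Ω := by
      rw [lt_div_iff₀ (by linarith)] at hω1
      linarith
    -- Here a = ω² and b = ρ^*ω²; the second is below mλ₁ by the first entry of the minimum.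
    obtain ⟨C, hC, hCu⟩ := exists_lower_bound (lam := lam) hΩ_bdd hΩ_open hmu hlm hm hmmu
      hω_pos.le (show 0 ≤ ρs * ω ^ 2 by positivity) hω2 hb'
    have hγ : 0 < (ρs - 1)⁻¹ := inv_pos.2 (by linarith)
    refine ⟨(ρs - 1)⁻¹ * C, by positivity, fun u hu => ?_⟩
    rw [hu.formA_self hΩ_bdd hΩ_open, Complex.ofReal_im, Complex.ofReal_re]
    refine ⟨rfl, ?_⟩
    -- Since 1 < ρ_* ≤ ρ ≤ ρ^*, minus the weight lies between 1/(ρ^*-1) and 1/(ρ_*-1); the upper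
    -- bound only serves integrability.
    have hw := hu.le_integral_weight (lam := lam) (mu := mu) (κ := fun x => -(1 - ρ x)⁻¹)
      (c := (ρs - 1)⁻¹) (B := (ρi - 1)⁻¹) hΩ_bdd hΩ_open hmeas.neg
      (by
        filter_upwards [hess] with x hx
        rw [← inv_neg, neg_sub]
        exact inv_anti₀ (by linarith [hx.1]) (by linarith [hx.2]))
      (by
        filter_upwards [hess] with x hx
        rw [← inv_neg, neg_sub, norm_inv, Real.norm_eq_abs,
          abs_of_pos (by linarith [hx.1])]
        exact inv_anti₀ (by linarith) (by linarith [hx.1])) ω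
    simp only [neg_mul] at hw
    rw [integral_neg] at hw
    have h1 := mul_le_mul_of_nonneg_left (hCu u hu) hγ.le
    have hγ' : (ρs - 1)⁻¹ * (ρs - 1) = 1 := inv_mul_cancel₀ (by linarith)
    have e : (ρs - 1)⁻¹ * (lameNormSq lam mu Ω u - (ω ^ 2 + ρs * ω ^ 2) * elasticEnergy lam mu Ω u
          + ω ^ 2 * (ρs * ω ^ 2) * normSq0 Ω u)
        = (ρs - 1)⁻¹ * (lameNormSq lam mu Ω u - 2 * ω ^ 2 * elasticEnergy lam mu Ω u
          + ω ^ 4 * normSq0 Ω u)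
          - (ρs - 1)⁻¹ * (ρs - 1) * (ω ^ 2 * elasticEnergy lam mu Ω u - ω ^ 4 * normSq0 Ω u) := by
      ring
    rw [e, hγ', one_mul] at h1
    rw [weightedPart]
    linarith
  · intro hup
    set ρs := essSup ρ (volume.restrict Ω)
    -- Here a = ω² and b = 0: the weight is at least 1, and ω⁴N cancels, leaving X - ω²D.
    obtain ⟨C, hC, hCu⟩ := exists_lower_bound (lam := lam) hΩ_bdd hΩ_open hmu hlm hm hmmu
      hω_pos.le le_rfl hω2 (hω_pos.trans hω2)
    refine ⟨C, hC, fun u hu => ?_⟩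
    rw [hu.formA_self hΩ_bdd hΩ_open, Complex.ofReal_im, Complex.ofReal_re]
    refine ⟨rfl, ?_⟩
    have hw := hu.le_integral_weight (lam := lam) (mu := mu) (κ := fun x => (1 - ρ x)⁻¹)
      (c := 1) (B := (1 - ρs)⁻¹) hΩ_bdd hΩ_open hmeas
      (by
        filter_upwards [hess, hρ_pos] with x hx hx0
        exact (one_le_inv₀ (by linarith [hx.2])).2 (by linarith))
      (by
        filter_upwards [hess] with x hx
        rw [norm_inv, Real.norm_eq_abs, abs_of_pos (by linarith [hx.2])]
        exact inv_anti₀ (by linarith) (by linarith [hx.2])) ω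
    have h1 := hCu u hu
    rw [weightedPart]
    linarith
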